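/- For $n\in\mathbb N$, a bounded domain in $\mathbb C^n$ is a nonempty connected bounded open set, and $\mathcal H^n$ denotes the set of bounded domains in $\mathbb C^n$ with the distance between two domains equal to the Hausdorff distance between their boundaries. A one-parameter group on a bounded domain $D$ is a continuous map $g:D\times\mathbb R\to D$ such that every $g(\cdot,t)$ is holomorphic, $g(z,0)=z$ and $g(z,t+s)=g(g(z,t),s)$ for all $z\in D$, $t,s\in\mathbb R$; it is nontrivial if $g(z,t)\neq z$ for some $z\in D$, $t\in\mathbb R$; and it generates the holomorphic vector field $X(z)=\frac{\partial g}{\partial t}(z,0)$ on $D$. Let $D_j$ be a sequence of bounded domains in $\mathbb C^n$ converging in $\mathcal H^n$ to a bounded domain $D$. Let $p\in D$ and $r,a>0$ be such that the ball $B(p,r+a)$ is contained in $D_j$ for every $j$. Let $g_j$ be nontrivial one-parameter groups on $D_j$, generating the vector fields $X_j$, and suppose that $\|X_j\|_{B(p,r)}=\sup_{z\in B(p,r)}|X_j(z)|=1$ for every $j$ (Euclidean norm). Then there are a subsequence $j_k$ and a nontrivial one-parameter group $g$ on $D$, generating a holomorphic vector field $X$ on $D$, such that $g_{j_k}\to g$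 uniformly on compacta in $D\times\mathbb R$ and $X_{j_k}\to X$ uniformly on compacta in $D$. (Convergence uniformly on compacta includes that every compact subset of $D$ is contained in $D_{j_k}$ for all large $k$.) -/

import Mathlib

open Filter Topology Set

/-- A bounded domain in `ℂⁿ`: a nonempty connected bounded open set. -/
structure IsBoundedDomain {n : ℕ} (D : Set (EuclideanSpace ℂ (Fin n))) : Prop where
  isOpen : IsOpen D
  isConnected : IsConnected D
  isBounded : Bornology.IsBounded D

/-- The distance between bounded domains: the Hausdorff distance between their boundaries. -/
noncomputable def boundaryDist {n : ℕ} (D E : Set (EuclideanSpace ℂ (Fin n))) : ℝ :=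
  Metric.hausdorffDist (frontier D) (frontier E)

/-- A one-parameter group `g(z,t)` of holomorphic automorphisms of `D`: a jointly continuous
action of `(ℝ,+)` on `D` by holomorphic maps (the inverse of `g(·,t)` is `g(·,-t)`).
Only the values `g z t` with `z ∈ D` matter. -/
structure IsOneParameterGroup {n : ℕ} (D : Set (EuclideanSpace ℂ (Fin n)))
    (g : EuclideanSpace ℂ (Fin n) → ℝ → EuclideanSpace ℂ (Fin n)) : Prop where
  mapsTo : ∀ t : ℝ, MapsTo (fun z => g z t) D D
  zero : ∀ z ∈ D, g z 0 = z
  add : ∀ z ∈ D, ∀ t s : ℝ, g z (t + s) = g (g z t) s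
  holomorphic : ∀ t : ℝ, DifferentiableOn ℂ (fun z => g z t) D
  continuous : ContinuousOn (fun q : EuclideanSpace ℂ (Fin n) × ℝ => g q.1 q.2) (D ×ˢ univ)

/-- The action `g` on `D` is nontrivial: some `g(·,t)` is not the identity of `D`. -/
def IsNontrivialOn {n : ℕ} (D : Set (EuclideanSpace ℂ (Fin n)))
    (g : EuclideanSpace ℂ (Fin n) → ℝ → EuclideanSpace ℂ (Fin n)) : Prop :=
  ∃ z ∈ D, ∃ t : ℝ, g z t ≠ z

/-- `X` is the vector field on `D` generated by `g`, that is, `X(z) = ∂g/∂t (z,0)`. -/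
def IsGenerator {n : ℕ} (D : Set (EuclideanSpace ℂ (Fin n)))
    (g : EuclideanSpace ℂ (Fin n) → ℝ → EuclideanSpace ℂ (Fin n))
    (X : EuclideanSpace ℂ (Fin n) → EuclideanSpace ℂ (Fin n)) : Prop :=
  ∀ z ∈ D, HasDerivAt (fun t : ℝ => g z t) (X z) 0

/-- Functions `F k`, defined on the sets `S k`, converge to `f` uniformly on compacta in `T`:
every compact subset of `T` lies in `S k` for all large `k`, and the convergence is uniform
on it. -/
def TendstoOnCompacta {α β : Type*} [TopologicalSpace α] [UniformSpace β]
    (S : ℕ → Set α) (F : ℕ → α → β) (T : Set α) (f : α → β) : Prop :=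
  ∀ K ⊆ T, IsCompact K → (∀ᶠ k in atTop, K ⊆ S k) ∧ TendstoUniformlyOn F f atTop K

/-!
Why the theorem holds.

Boundaries close to `∂D` in the Hausdorff distance, together with the common point `p`, force every
compact subset of `D` into `D_j` for large `j` (`eventually_mem_nhds`), and the `D_j` lie in a
common ball (`exists_eventually_subset_closedBall`). Hence all the maps `g_j(·, t)` form a normal
family on `D`.

The bound `|X_j| ≤ 1` on `B(p, r)` gives `|g_j(z, t) - z| ≤ 2|t|` for `z` near `p` and small `t`,
so every limit of the maps `g_j(·, t)` as `j → ∞`, `t → 0` is holomorphic on `D` and is the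
identity near `p`. By the identity theorem `g_j(·, t) → id` locally uniformly on all of `D`
(`IsBoundedFlowSeq.contConvAt_id`). Through the group law this makes the `g_j` equicontinuous on
`D × ℝ`, and a subsequence converges there to some `g` (`IsBoundedFlowSeq.exists_subseq`).

The limit could leave `D` only through a boundary point. For small `t` the Jacobian determinant of
`g(·, t)` is close to `1` at `p`; being a limit of zero-free functions, it is zero-free on `D` by
Hurwitz' theorem (`ne_zero_of_contConvAt`). The inverse function theorem then puts a fixed ball
around `g(z, t)` into `D_j` for large `j`, whereas near a point of `∂D` there are points outside
`D_j`. So `g(z, t) ∉ ∂D`, and `g(z, t) ∈ D` by connectedness in `t`; the group law covers large `t`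
(`IsBoundedFlowSeq.limit_mapsTo`).

For the generators, `X_j(g_j(z, s)) = dg_j(·, s)(z) X_j(z)`, where `dg_j(·, s)` is close to the
identity for small `s`. Integrating, `g_j(z, T) - z - T X_j(z)` is at most a small multiple of
`|T| |X_j(z)|`. As `g_j(z, T) - z` is bounded, this bounds `X_j` locally, and then shows that `X_j`
is, uniformly in `j`, the limit of difference quotients of `g_j`. Hence the `X_j` converge to the
generator of `g`, which is holomorphic. It is not zero, because `sup |X_j| = 1` on `B(p, r)`, whose
closure is a compact subset of `D`.
-/

/-! ### Continuous convergence -/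

section ContinuousConvergence

/-- `F i` converges continuously to `f` at `z` along `l`: `F i w → f z` as `i → l` and `w → z`
jointly. On open subsets of a locally compact space, this at every point amounts to
locally uniform convergence to a continuous limit, and it is stable under composition. -/
def ContConvAt {ι α β : Type*} [TopologicalSpace α] [TopologicalSpace β]
    (F : ι → α → β) (l : Filter ι) (f : α → β) (z : α) : Prop :=
  Tendsto (fun q : ι × α => F q.1 q.2) (l ×ˢ 𝓝 z) (𝓝 (f z))

variable {ι α β : Type*} [TopologicalSpace α] [PseudoMetricSpace β]
  {F : ι → α → β} {l : Filter ι} {f : α → β}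

lemma ContConvAt.tendsto {z : α} (h : ContConvAt F l f z) :
    Tendsto (fun i => F i z) l (𝓝 (f z)) :=
  Tendsto.comp h (tendsto_id.prodMk (tendsto_const_nhds (x := z)))

lemma ContConvAt.mono {z : α} {l' : Filter ι} (h : ContConvAt F l f z) (hl : l' ≤ l) :
    ContConvAt F l' f z :=
  Tendsto.mono_left h (prod_mono hl le_rfl)

lemma ContConvAt.continuousWithinAt [NeBot l] {S : Set α} {z : α} (hz : ContConvAt F l f z)
    (h : ∀ w ∈ S, ContConvAt F l f w) : ContinuousWithinAt f S z := by
  rw [ContinuousWithinAt, Metric.tendsto_nhds]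
  intro ε hε
  have h1 := (Metric.tendsto_nhds.1 hz) (ε / 2) (by positivity)
  obtain ⟨pa, hpa, pb, hpb, hab⟩ := eventually_prod_iff.1 h1
  filter_upwards [mem_nhdsWithin_of_mem_nhds hpb, self_mem_nhdsWithin] with w hw hwS
  have h2 : Tendsto (fun i => dist (F i w) (f z)) l (𝓝 (dist (f w) (f z))) :=
    (h w hwS).tendsto.dist tendsto_const_nhds
  have h3 : dist (f w) (f z) ≤ ε / 2 :=
    le_of_tendsto h2 (hpa.mono fun i hi => (hab hi hw).le)
  linarith

lemma continuousOn_of_contConvAt [NeBot l] {S : Set α} (h : ∀ w ∈ S, ContConvAt F l f w) :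
    ContinuousOn f S := fun z hz => (h z hz).continuousWithinAt h

lemma tendstoUniformlyOn_of_contConvAt [NeBot l] {K : Set α} (hK : IsCompact K)
    (h : ∀ w ∈ K, ContConvAt F l f w) : TendstoUniformlyOn F f l K := by
  rw [← tendstoLocallyUniformlyOn_iff_tendstoUniformlyOn_of_compact hK,
    Metric.tendstoLocallyUniformlyOn_iff]
  intro ε hε z hz
  have h1 := (Metric.tendsto_nhds.1 (h z hz)) (ε / 2) (by positivity)
  obtain ⟨pa, hpa, pb, hpb, hab⟩ := eventually_prod_iff.1 h1
  have h2 := Metric.tendsto_nhds.1 ((h z hz).continuousWithinAt h) (ε / 2) (by positivity)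
  refine ⟨_, inter_mem (mem_nhdsWithin_of_mem_nhds hpb) h2, ?_⟩
  filter_upwards [hpa] with i hi w hw
  have h3 := hab hi hw.1
  have h4 : dist (f w) (f z) < ε / 2 := hw.2
  calc dist (f w) (F i w) ≤ dist (f w) (f z) + dist (F i w) (f z) := dist_triangle_right _ _ _
    _ < ε := by linarith [h3]

/-- A property that holds locally near every point of a compact set, for indices far along `l`,
holds on the whole compact set far along `l`. -/
lemma eventually_forall_mem_of_isCompact {K : Set α} (hK : IsCompact K) {P : ι → α → Prop}
    (h : ∀ z ∈ K, ∀ᶠ q in l ×ˢ 𝓝 z, P q.1 q.2) : ∀ᶠ i in l, ∀ z ∈ K, P i z := by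
  refine hK.induction_on (p := fun S => ∀ᶠ i in l, ∀ z ∈ S, P i z) (by simp) ?_ ?_ ?_
  · intro s t hst ht
    filter_upwards [ht] with i hi z hz using hi z (hst hz)
  · intro s t hs ht
    filter_upwards [hs, ht] with i hi hi' z hz
    exact hz.elim (hi z) (hi' z)
  · intro z hz
    obtain ⟨pa, hpa, pb, hpb, hab⟩ := eventually_prod_iff.1 (h z hz)
    exact ⟨_, mem_nhdsWithin_of_mem_nhds hpb, hpa.mono fun i hi w hw => hab hi hw⟩

end ContinuousConvergence

/-! ### Cauchy estimates and Weierstrass' theorem in several variables -/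

section Holomorphic

variable {E F : Type*} [NormedAddCommGroup E] [NormedSpace ℂ E] [NormedAddCommGroup F]
  [NormedSpace ℂ F]

lemma norm_fderiv_le_of_forall_mem_ball {f : E → F} {z : E} {ρ C : ℝ} (hρ : 0 < ρ)
    (hf : DifferentiableOn ℂ f (Metric.ball z ρ)) (hC : ∀ w ∈ Metric.ball z ρ, ‖f w‖ ≤ C) :
    ‖fderiv ℂ f z‖ ≤ 2 * C / ρ := by
  refine Complex.norm_fderiv_le_div_of_mapsTo_ball hf (fun w hw => ?_) hρ
  rw [mem_closedBall_iff_norm]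
  have := norm_sub_le (f w) (f z)
  linarith [hC w hw, hC z (Metric.mem_ball_self hρ)]

/-- Uniformly bounded holomorphic maps are equi-Lipschitz in the interior. -/
lemma norm_sub_le_of_forall_mem_ball {f : E → F} {z : E} {ρ C : ℝ} (hρ : 0 < ρ)
    (hf : DifferentiableOn ℂ f (Metric.ball z (2 * ρ)))
    (hC : ∀ w ∈ Metric.ball z (2 * ρ), ‖f w‖ ≤ C) {x y : E} (hx : x ∈ Metric.ball z ρ)
    (hy : y ∈ Metric.ball z ρ) : ‖f y - f x‖ ≤ 2 * C / ρ * ‖y - x‖ := by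
  have hsub : ∀ w ∈ Metric.ball z ρ, Metric.ball w ρ ⊆ Metric.ball z (2 * ρ) := fun w hw =>
    Metric.ball_subset_ball' (by have := Metric.mem_ball.1 hw; linarith)
  refine (convex_ball z ρ).norm_image_sub_le_of_norm_fderiv_le (𝕜 := ℂ) (fun w hw => ?_)
    (fun w hw => ?_) hx hy
  · exact hf.differentiableAt (Metric.isOpen_ball.mem_nhds (hsub w hw (Metric.mem_ball_self hρ)))
  · exact norm_fderiv_le_of_forall_mem_ball hρ (hf.mono (hsub w hw))
      fun v hv => hC v (hsub w hw hv)

variable [FiniteDimensional ℂ E] [CompleteSpace F]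

/-- **Weierstrass' theorem**, first half: a locally uniform limit of holomorphic maps is
holomorphic. -/
lemma differentiableAt_of_contConvAt {ι : Type*} {l : Filter ι} [NeBot l] {G : ι → E → F}
    {f : E → F} {U : Set E} (hU : IsOpen U)
    (hG : ∀ z ∈ U, ∀ᶠ q in l ×ˢ 𝓝 z, DifferentiableAt ℂ (G q.1) q.2)
    (h : ∀ z ∈ U, ContConvAt G l f z) {z : E} (hz : z ∈ U) : DifferentiableAt ℂ f z := by
  have : ProperSpace E := FiniteDimensional.proper ℂ E
  obtain ⟨ρ, hρ, hρU⟩ := Metric.nhds_basis_closedBall.mem_iff.1 (hU.mem_nhds hz)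
  have hK := isCompact_closedBall z ρ
  have hunif := tendstoUniformlyOn_of_contConvAt hK fun w hw => h w (hρU hw)
  have hdiff := eventually_forall_mem_of_isCompact (P := fun i w => DifferentiableAt ℂ (G i) w) hK
    fun w hw => hG w (hρU hw)
  have hsub : ∀ w ∈ Metric.ball z (ρ / 2), Metric.ball w (ρ / 2) ⊆ Metric.closedBall z ρ :=
    fun w hw => (Metric.ball_subset_ball'
      (by have := Metric.mem_ball.1 hw; linarith)).trans Metric.ball_subset_closedBall
  -- Cauchy's estimate for the differences `G i - G j`.
  have key : ∀ ε > 0, ∀ᶠ m : ι × ι in l ×ˢ l, ∀ w ∈ Metric.ball z (ρ / 2),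
      dist (fderiv ℂ (G m.1) w) (fderiv ℂ (G m.2) w) < ε := by
    intro ε hε
    have h1 : ∀ᶠ i in l, ∀ w ∈ Metric.closedBall z ρ, dist (f w) (G i w) < ε * ρ / 16 :=
      Metric.tendstoUniformlyOn_iff.1 hunif _ (by positivity)
    have h2 := h1.and hdiff
    filter_upwards [h2.prod_mk h2] with m hm w hw
    obtain ⟨⟨ha, hb⟩, hc, hd⟩ := hm
    have hws := hsub w hw
    have hw0 : w ∈ Metric.closedBall z ρ := hws (Metric.mem_ball_self (by positivity))
    rw [dist_eq_norm, ← fderiv_fun_sub (hb w hw0) (hd w hw0)]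
    have := norm_fderiv_le_of_forall_mem_ball (f := fun w => G m.1 w - G m.2 w) (z := w)
      (ρ := ρ / 2) (C := ε * ρ / 8) (by positivity)
      (fun v hv => ((hb v (hws hv)).sub (hd v (hws hv))).differentiableWithinAt) (fun v hv => by
        rw [← dist_eq_norm]
        have := dist_triangle_left (G m.1 v) (G m.2 v) (f v)
        linarith [ha v (hws hv), hc v (hws hv)])
    refine this.trans_lt ?_
    rw [div_lt_iff₀ (by positivity)]
    nlinarith
  have hball : Metric.ball z (ρ / 2) ∈ 𝓝 z := Metric.ball_mem_nhds z (by positivity)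
  have hlim : ∀ w ∈ Metric.ball z (ρ / 2), ∃ A, Tendsto (fun i => fderiv ℂ (G i) w) l (𝓝 A) := by
    intro w hw
    refine cauchy_map_iff_exists_tendsto.1 ?_
    rw [cauchy_map_iff]
    refine ⟨inferInstance, ?_⟩
    rw [Metric.uniformity_basis_dist.tendsto_right_iff]
    intro ε hε
    exact (key ε hε).mono fun m hm => hm w hw
  choose! g' hg' using hlim
  refine HasFDerivAt.differentiableAt (f' := g' z) ?_
  refine hasFDerivAt_of_tendstoUniformlyOnFilter (l := l) (f := G) (f' := fun i => fderiv ℂ (G i))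
    ?_ ?_ ?_
  · refine UniformCauchySeqOnFilter.tendstoUniformlyOnFilter_of_tendsto ?_
      (eventually_of_mem hball hg')
    intro u hu
    obtain ⟨ε, hε, hεu⟩ := Metric.mem_uniformity_dist.1 hu
    filter_upwards [(key ε hε).prod_mk hball] with m hm
    exact hεu (hm.1 m.2 hm.2)
  · exact (hG z hz).mono fun q hq => hq.hasFDerivAt
  · filter_upwards [hball] with w hw
    exact (h w (hρU (hsub w hw (Metric.mem_ball_self (by positivity))))).tendsto

/-- **Weierstrass' theorem**, second half: the derivatives converge locally uniformly as well. -/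
lemma contConvAt_fderiv {ι : Type*} {l : Filter ι} [NeBot l] {G : ι → E → F}
    {f : E → F} {U : Set E} (hU : IsOpen U)
    (hG : ∀ z ∈ U, ∀ᶠ q in l ×ˢ 𝓝 z, DifferentiableAt ℂ (G q.1) q.2)
    (h : ∀ z ∈ U, ContConvAt G l f z) {z : E} (hz : z ∈ U) :
    ContConvAt (fun i => fderiv ℂ (G i)) l (fderiv ℂ f) z := by
  have : ProperSpace E := FiniteDimensional.proper ℂ E
  have hf : ∀ w ∈ U, DifferentiableAt ℂ f w := fun w hw =>
    differentiableAt_of_contConvAt hU hG h hw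
  obtain ⟨ρ, hρ, hρU⟩ := Metric.nhds_basis_closedBall.mem_iff.1 (hU.mem_nhds hz)
  have hK := isCompact_closedBall z ρ
  have hunif := tendstoUniformlyOn_of_contConvAt hK fun w hw => h w (hρU hw)
  have hdiff := eventually_forall_mem_of_isCompact (P := fun i w => DifferentiableAt ℂ (G i) w) hK
    fun w hw => hG w (hρU hw)
  have huc : UniformContinuousOn f (Metric.closedBall z ρ) :=
    hK.uniformContinuousOn_of_continuous fun w hw =>
      (hf w (hρU hw)).continuousAt.continuousWithinAt
  rw [ContConvAt, Metric.tendsto_nhds]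
  intro ε hε
  obtain ⟨δ, hδ, hδf⟩ := Metric.uniformContinuousOn_iff.1 huc (ε * ρ / 16) (by positivity)
  have h1 : ∀ᶠ i in l, ∀ w ∈ Metric.closedBall z ρ, dist (f w) (G i w) < ε * ρ / 16 :=
    Metric.tendstoUniformlyOn_iff.1 hunif _ (by positivity)
  have hball : Metric.ball z (min δ (ρ / 2)) ∈ 𝓝 z := Metric.ball_mem_nhds z (by positivity)
  filter_upwards [(h1.and hdiff).prod_mk hball] with q hq
  obtain ⟨⟨ha, hb⟩, hc⟩ := hq
  have hc1 : dist q.2 z < δ := lt_of_lt_of_le (Metric.mem_ball.1 hc) (min_le_left _ _)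
  have hc2 : dist q.2 z < ρ / 2 := lt_of_lt_of_le (Metric.mem_ball.1 hc) (min_le_right _ _)
  -- Compare `G i` and `f` after moving both base points to the origin.
  have hm1 : ∀ w ∈ Metric.ball (0 : E) (ρ / 2), q.2 + w ∈ Metric.closedBall z ρ := by
    intro w hw
    rw [mem_closedBall_iff_norm]
    rw [mem_ball_zero_iff] at hw
    rw [dist_eq_norm] at hc2
    calc ‖q.2 + w - z‖ = ‖(q.2 - z) + w‖ := by congr 1; abel
      _ ≤ ‖q.2 - z‖ + ‖w‖ := norm_add_le _ _
      _ ≤ ρ := by linarith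
  have hm2 : ∀ w ∈ Metric.ball (0 : E) (ρ / 2), z + w ∈ Metric.closedBall z ρ := by
    intro w hw
    rw [mem_closedBall_iff_norm, add_sub_cancel_left]
    rw [mem_ball_zero_iff] at hw
    linarith
  have h0 : (0 : E) ∈ Metric.ball (0 : E) (ρ / 2) := Metric.mem_ball_self (by positivity)
  have hd1 : ∀ w ∈ Metric.ball (0 : E) (ρ / 2), DifferentiableAt ℂ (fun w => G q.1 (q.2 + w)) w :=
    fun w hw => (hb _ (hm1 w hw)).comp w (by fun_prop)
  have hd2 : ∀ w ∈ Metric.ball (0 : E) (ρ / 2), DifferentiableAt ℂ (fun w => f (z + w)) w :=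
    fun w hw => (hf _ (hρU (hm2 w hw))).comp w (by fun_prop)
  have heq : fderiv ℂ (fun w => G q.1 (q.2 + w) - f (z + w)) 0
      = fderiv ℂ (G q.1) q.2 - fderiv ℂ f z := by
    rw [fderiv_fun_sub (hd1 0 h0) (hd2 0 h0), fderiv_comp_add_left, fderiv_comp_add_left, add_zero,
      add_zero]
  rw [dist_eq_norm, ← heq]
  have := norm_fderiv_le_of_forall_mem_ball (f := fun w => G q.1 (q.2 + w) - f (z + w)) (z := 0)
    (ρ := ρ / 2) (C := ε * ρ / 8) (by positivity)
    (fun w hw => ((hd1 w hw).sub (hd2 w hw)).differentiableWithinAt) (fun w hw => by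
      rw [← dist_eq_norm]
      have h3 := hδf (q.2 + w) (hm1 w hw) (z + w) (hm2 w hw) (by simpa using hc1)
      have h4 := ha _ (hm1 w hw)
      have := dist_triangle_left (G q.1 (q.2 + w)) (f (z + w)) (f (q.2 + w))
      linarith)
  refine this.trans_lt ?_
  rw [div_lt_iff₀ (by positivity)]
  nlinarith

lemma continuousOn_fderiv {f : E → F} {U : Set E} (hU : IsOpen U) (hf : DifferentiableOn ℂ f U) :
    ContinuousOn (fderiv ℂ f) U := by
  have hd : ∀ z ∈ U, ∀ᶠ q : Unit × E in (⊤ : Filter Unit) ×ˢ 𝓝 z, DifferentiableAt ℂ f q.2 :=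
    fun z hz => tendsto_snd.eventually ((hU.eventually_mem hz).mono fun w hw =>
      hf.differentiableAt (hU.mem_nhds hw))
  have hc : ∀ z ∈ U, ContConvAt (fun _ : Unit => f) ⊤ f z := fun z hz =>
    (hf.differentiableAt (hU.mem_nhds hz)).continuousAt.tendsto.comp tendsto_snd
  exact continuousOn_of_contConvAt (l := (⊤ : Filter Unit)) (F := fun _ => fderiv ℂ f)
    fun z hz => contConvAt_fderiv (G := fun _ : Unit => f) hU hd hc hz

/-- Directional derivatives of a holomorphic map are holomorphic, being locally uniform limits of
difference quotients. -/
lemma differentiableOn_fderiv_apply {f : E → F} {U : Set E} (hU : IsOpen U)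
    (hf : DifferentiableOn ℂ f U) (v : E) : DifferentiableOn ℂ (fun z => fderiv ℂ f z v) U := by
  have hd : ∀ z ∈ U, ∀ᶠ w in 𝓝 z, DifferentiableAt ℂ f w := fun z hz =>
    (hU.eventually_mem hz).mono fun w hw => hf.differentiableAt (hU.mem_nhds hw)
  have hshift : ∀ z, Tendsto (fun q : ℂ × E => q.2 + q.1 • v) (𝓝[≠] (0 : ℂ) ×ˢ 𝓝 z) (𝓝 z) := by
    intro z
    have : Tendsto (fun q : ℂ × E => q.2 + q.1 • v) (𝓝 ((0 : ℂ), z)) (𝓝 (z + (0 : ℂ) • v)) :=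
      (show Continuous (fun q : ℂ × E => q.2 + q.1 • v) by fun_prop).tendsto _
    rw [zero_smul, add_zero, nhds_prod_eq] at this
    exact this.mono_left (prod_mono nhdsWithin_le_nhds le_rfl)
  intro z hz
  refine (differentiableAt_of_contConvAt (l := 𝓝[≠] (0 : ℂ))
    (G := fun (c : ℂ) w => c⁻¹ • (f (w + c • v) - f w)) hU ?_ ?_ hz).differentiableWithinAt
  · intro z hz
    filter_upwards [(hshift z).eventually (hd z hz), tendsto_snd.eventually (hd z hz)] with q h1 h2
    exact ((h1.comp q.2 (by fun_prop : DifferentiableAt ℂ (fun w => w + q.1 • v) q.2)).sub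
      h2).const_smul _
  · intro z hz
    have hs : HasStrictFDerivAt f (fderiv ℂ f z) z :=
      hasStrictFDerivAt_of_hasFDerivAt_of_continuousAt
        ((hd z hz).mono fun w hw => hw.hasFDerivAt)
        ((continuousOn_fderiv hU hf).continuousAt (hU.mem_nhds hz))
    have hs' := (hasStrictFDerivAt_iff_isLittleO.1 hs).comp_tendsto
      (((hshift z).prodMk_nhds tendsto_snd : Tendsto (fun q : ℂ × E => (q.2 + q.1 • v, q.2))
        (𝓝[≠] (0 : ℂ) ×ˢ 𝓝 z) (𝓝 (z, z))))
    rw [ContConvAt, Metric.tendsto_nhds]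
    intro ε hε
    have hb := hs'.bound (c := ε / (2 * (‖v‖ + 1))) (by positivity)
    filter_upwards [hb, tendsto_fst.eventually (self_mem_nhdsWithin (s := {0}ᶜ) (a := (0 : ℂ)))]
      with q h1 h2
    have h2' : q.1 ≠ 0 := h2
    simp only [Function.comp_apply, add_sub_cancel_left, map_smul] at h1
    rw [dist_eq_norm]
    have : q.1⁻¹ • (f (q.2 + q.1 • v) - f q.2) - fderiv ℂ f z v
        = q.1⁻¹ • (f (q.2 + q.1 • v) - f q.2 - q.1 • fderiv ℂ f z v) := by
      rw [smul_sub q.1⁻¹ (_ - _), smul_smul, inv_mul_cancel₀ h2', one_smul]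
    rw [this, norm_smul, norm_inv]
    have hq : 0 < ‖q.1‖ := norm_pos_iff.2 h2'
    rw [norm_smul] at h1
    calc ‖q.1‖⁻¹ * ‖_‖ ≤ ‖q.1‖⁻¹ * (ε / (2 * (‖v‖ + 1)) * (‖q.1‖ * ‖v‖)) := by gcongr
      _ = ε / 2 * (‖v‖ / (‖v‖ + 1)) := by field_simp
      _ ≤ ε / 2 * 1 := by
        gcongr
        rw [div_le_one (by positivity)]
        linarith
      _ < ε := by linarith

end Holomorphic

/-! ### Identity theorem, Hurwitz' theorem and the Jacobian determinant -/

section IdentityAndHurwitz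

variable {E F : Type*} [NormedAddCommGroup E] [NormedSpace ℂ E] [NormedAddCommGroup F]
  [NormedSpace ℂ F]

/-- The restriction of a holomorphic map to a complex line is holomorphic. -/
lemma differentiableOn_comp_line {f : E → F} {U : Set E} (hU : IsOpen U)
    (hf : DifferentiableOn ℂ f U) (z v : E) :
    DifferentiableOn ℂ (fun c : ℂ => f (z + c • v)) ((fun c : ℂ => z + c • v) ⁻¹' U) :=
  fun c hc => ((hf.differentiableAt (hU.mem_nhds hc)).comp c
    (by fun_prop : DifferentiableAt ℂ (fun c : ℂ => z + c • v) c)).differentiableWithinAt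

/-- A holomorphic map on a ball that vanishes near one point of the ball vanishes on the ball:
restrict it to the complex lines through that point. -/
lemma eq_zero_of_mem_ball [CompleteSpace F] {f : E → F} {z z₁ w : E} {ρ : ℝ}
    (hf : DifferentiableOn ℂ f (Metric.ball z ρ)) (hz₁ : z₁ ∈ Metric.ball z ρ)
    (h0 : ∀ᶠ y in 𝓝 z₁, f y = 0) (hw : w ∈ Metric.ball z ρ) : f w = 0 := by
  set S : Set ℂ := (fun c : ℂ => z₁ + c • (w - z₁)) ⁻¹' Metric.ball z ρ with hS
  have hcont : Continuous (fun c : ℂ => z₁ + c • (w - z₁)) := by fun_prop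
  have hSo : IsOpen S := Metric.isOpen_ball.preimage hcont
  have hSc : Convex ℝ S := by
    intro a ha b hb s t hs ht hst
    have := convex_ball z ρ ha hb hs ht hst
    have h2 : s • (z₁ + a • (w - z₁)) + t • (z₁ + b • (w - z₁))
        = z₁ + (s • a + t • b) • (w - z₁) := by
      rw [smul_add, smul_add, add_smul, smul_assoc, smul_assoc, add_add_add_comm, ← add_smul, hst,
        one_smul]
    rwa [h2] at this
  have han : AnalyticOnNhd ℂ (fun c : ℂ => f (z₁ + c • (w - z₁))) S :=
    (differentiableOn_comp_line Metric.isOpen_ball hf z₁ (w - z₁)).analyticOnNhd hSo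
  have h0S : (0 : ℂ) ∈ S := by simpa [hS] using hz₁
  have h1S : (1 : ℂ) ∈ S := by simpa [hS] using hw
  have hev : (fun c : ℂ => f (z₁ + c • (w - z₁))) =ᶠ[𝓝 0] 0 := by
    have ht : Tendsto (fun c : ℂ => z₁ + c • (w - z₁)) (𝓝 0) (𝓝 z₁) := by
      have := hcont.tendsto 0
      rwa [zero_smul, add_zero] at this
    exact ht.eventually h0
  have := han.eqOn_zero_of_preconnected_of_eventuallyEq_zero hSc.isPreconnected h0S hev h1S
  simpa using this

/-- **Identity theorem** for holomorphic maps of several complex variables. -/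
lemma eqOn_zero_of_eventually_eq_zero [CompleteSpace F] {f : E → F} {U : Set E} (hU : IsOpen U)
    (hUc : IsPreconnected U) (hf : DifferentiableOn ℂ f U) {z₀ : E} (hz₀ : z₀ ∈ U)
    (h0 : ∀ᶠ y in 𝓝 z₀, f y = 0) {z : E} (hz : z ∈ U) : f z = 0 := by
  have hsub : U ⊆ {z | ∀ᶠ y in 𝓝 z, f y = 0} := by
    refine hUc.subset_of_closure_inter_subset isOpen_setOfPred_eventually_nhds ⟨z₀, hz₀, h0⟩ ?_
    rintro z ⟨hzc, hzU⟩
    obtain ⟨ρ, hρ, hρU⟩ := Metric.isOpen_iff.1 hU z hzU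
    obtain ⟨z₁, hz₁, hd⟩ := Metric.mem_closure_iff.1 hzc ρ hρ
    filter_upwards [Metric.ball_mem_nhds z hρ] with w hw
    exact eq_zero_of_mem_ball (hf.mono hρU) (by rwa [Metric.mem_ball']) hz₁ hw
  exact (hsub hz).self_of_nhds

/-- **Hurwitz' theorem** in several variables: a locally uniform limit of zero-free holomorphic
functions on a connected open set is zero-free unless it vanishes identically. -/
lemma ne_zero_of_contConvAt [FiniteDimensional ℂ E] {ι : Type*} {l : Filter ι} [NeBot l]
    {G : ι → E → ℂ} {f : E → ℂ} {U : Set E} (hU : IsOpen U) (hUc : IsPreconnected U)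
    (hG : ∀ z ∈ U, ∀ᶠ q in l ×ˢ 𝓝 z, DifferentiableAt ℂ (G q.1) q.2 ∧ G q.1 q.2 ≠ 0)
    (h : ∀ z ∈ U, ContConvAt G l f z) {z₀ : E} (hz₀ : z₀ ∈ U) (h0 : f z₀ ≠ 0) {z : E}
    (hz : z ∈ U) : f z ≠ 0 := by
  intro hfz
  have : ProperSpace E := FiniteDimensional.proper ℂ E
  have hf : DifferentiableOn ℂ f U := fun w hw => (differentiableAt_of_contConvAt hU
    (fun z hz => (hG z hz).mono fun q hq => hq.1) h hw).differentiableWithinAt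
  obtain ⟨ρ, hρ, hρU⟩ := Metric.nhds_basis_closedBall.mem_iff.1 (hU.mem_nhds hz)
  have hK := isCompact_closedBall z ρ
  obtain ⟨w, hw, hfw⟩ : ∃ w ∈ Metric.ball z (ρ / 2), f w ≠ 0 := by
    by_contra hcon
    push Not at hcon
    exact h0 (eqOn_zero_of_eventually_eq_zero hU hUc hf hz
      (eventually_of_mem (Metric.ball_mem_nhds z (by positivity)) hcon) hz₀)
  -- The restriction to the complex line through `z` and `w`.
  set v := w - z with hv
  have hvn : ‖v‖ < ρ / 2 := by rwa [hv, ← mem_ball_iff_norm]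
  have hline : ∀ c ∈ Metric.ball (0 : ℂ) 2, z + c • v ∈ Metric.closedBall z ρ := by
    intro c hc
    rw [mem_ball_zero_iff] at hc
    rw [mem_closedBall_iff_norm, add_sub_cancel_left, norm_smul]
    nlinarith [norm_nonneg c, norm_nonneg v]
  have han : AnalyticOnNhd ℂ (fun c : ℂ => f (z + c • v)) (Metric.ball 0 2) :=
    ((differentiableOn_comp_line hU hf z v).mono fun c hc => hρU (hline c hc)).analyticOnNhd
      Metric.isOpen_ball
  have h02 : (0 : ℂ) ∈ Metric.ball (0 : ℂ) 2 := Metric.mem_ball_self (by norm_num)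
  have hne : ∀ᶠ c in 𝓝[≠] (0 : ℂ), f (z + c • v) ≠ 0 := by
    refine (han 0 h02).eventually_eq_zero_or_eventually_ne_zero.resolve_left fun hev => hfw ?_
    have := han.eqOn_zero_of_preconnected_of_eventuallyEq_zero
      (convex_ball (0 : ℂ) 2).isPreconnected h02 hev (x := 1) (by simp)
    simpa [hv] using this
  rw [eventually_nhdsWithin_iff, Metric.eventually_nhds_iff] at hne
  obtain ⟨σ, hσ, hne⟩ := hne
  set s := min (σ / 2) 1 with hs
  have hs0 : 0 < s := by positivity
  have hsσ : s < σ := (min_le_left _ _).trans_lt (by linarith)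
  have hs1 : s ≤ 1 := min_le_right _ _
  have hsball : Metric.closedBall (0 : ℂ) s ⊆ Metric.ball 0 2 :=
    Metric.closedBall_subset_ball (by linarith)
  have hsph : ∀ c ∈ Metric.sphere (0 : ℂ) s, f (z + c • v) ≠ 0 := by
    intro c hc
    have hc' : dist c 0 = s := hc
    exact hne (by rw [hc']; exact hsσ) (Metric.ne_of_mem_sphere hc hs0.ne')
  have hcontf : ContinuousOn (fun c : ℂ => ‖f (z + c • v)‖) (Metric.sphere 0 s) :=
    (han.continuousOn.mono (Metric.sphere_subset_closedBall.trans hsball)).norm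
  obtain ⟨c₀, hc₀, hmin⟩ := (isCompact_sphere (0 : ℂ) s).exists_isMinOn
    (NormedSpace.sphere_nonempty.2 hs0.le) hcontf
  set m := ‖f (z + c₀ • v)‖ with hm
  have hm0 : 0 < m := norm_pos_iff.2 (hsph c₀ hc₀)
  have hunif := Metric.tendstoUniformlyOn_iff.1
    (tendstoUniformlyOn_of_contConvAt hK fun w hw => h w (hρU hw)) (m / 2) (by positivity)
  have hgood := eventually_forall_mem_of_isCompact
    (P := fun i w => DifferentiableAt ℂ (G i) w ∧ G i w ≠ 0) hK fun w hw => hG w (hρU hw)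
  have hbig : ∀ᶠ i in l, m / 2 ≤ ‖G i z‖ := by
    filter_upwards [hunif, hgood] with i h1 h2
    -- The maximum principle for `1 / G i` on the disc of radius `s`.
    have hd : DiffContOnCl ℂ (fun c : ℂ => (G i (z + c • v))⁻¹) (Metric.ball 0 s) := by
      refine DifferentiableOn.diffContOnCl ?_
      rw [closure_ball _ hs0.ne']
      intro c hc
      have hk := h2 _ (hline c (hsball hc))
      have hk1 : DifferentiableAt ℂ (fun c : ℂ => G i (z + c • v)) c :=
        hk.1.comp c (by fun_prop : DifferentiableAt ℂ (fun c : ℂ => z + c • v) c)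
      exact (hk1.inv hk.2).differentiableWithinAt
    have hmax := Complex.norm_le_of_forall_mem_frontier_norm_le (C := 2 / m) Metric.isBounded_ball
      hd (fun c hc => ?_) (subset_closure (Metric.mem_ball_self hs0))
    · rw [zero_smul, add_zero, norm_inv] at hmax
      have hpos : 0 < ‖G i z‖ := norm_pos_iff.2 (h2 z (Metric.mem_closedBall_self hρ.le)).2
      have := inv_le_of_inv_le₀ hpos hmax
      rwa [inv_div] at this
    · rw [frontier_ball _ hs0.ne'] at hc
      have hk := h1 _ (hline c (hsball (Metric.sphere_subset_closedBall hc)))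
      have hmc : m ≤ ‖f (z + c • v)‖ := hmin hc
      rw [dist_eq_norm] at hk
      have := norm_sub_norm_le (f (z + c • v)) (G i (z + c • v))
      rw [norm_inv, ← inv_div]
      exact inv_anti₀ (by positivity) (by linarith)
  have hlim : Tendsto (fun i => ‖G i z‖) l (𝓝 0) := by
    simpa [hfz] using (h z hz).tendsto.norm
  have := ge_of_tendsto hlim hbig
  linarith

end IdentityAndHurwitz

section Jacobian

variable {E : Type*} [NormedAddCommGroup E] [NormedSpace ℂ E] [FiniteDimensional ℂ E]

lemma differentiableOn_det_fderiv {f : E → E} {U : Set E} (hU : IsOpen U)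
    (hf : DifferentiableOn ℂ f U) : DifferentiableOn ℂ (fun z => (fderiv ℂ f z).det) U := by
  have : CompleteSpace E := FiniteDimensional.complete ℂ E
  set b := Module.finBasis ℂ E
  have hdet : ∀ z, (fderiv ℂ f z).det = ∑ σ : Equiv.Perm (Fin (Module.finrank ℂ E)),
      ((Equiv.Perm.sign σ : ℤ) : ℂ) * ∏ i, (LinearMap.toContinuousLinearMap (b.coord (σ i)))
        (fderiv ℂ f z (b i)) := by
    intro z
    rw [ContinuousLinearMap.det, ← LinearMap.det_toMatrix b, Matrix.det_apply']
    simp [LinearMap.toMatrix_apply]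
  simp only [hdet]
  refine DifferentiableOn.fun_sum fun σ _ => ?_
  refine DifferentiableOn.const_mul (𝔸 := ℂ) (fun z hz => ?_) _
  refine (HasFDerivAt.finsetProd (u := Finset.univ) fun i _ => DifferentiableAt.hasFDerivAt
    (DifferentiableOn.differentiableAt ?_ (hU.mem_nhds hz))).differentiableAt.differentiableWithinAt
  exact (ContinuousLinearMap.differentiable _).comp_differentiableOn
    (differentiableOn_fderiv_apply hU hf (b i))

/-- Locally uniform convergence to a map that is nondegenerate at `z` makes the approximating
maps cover a fixed ball around the limit value, by the quantitative inverse function theorem. -/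
lemma exists_ball_subset_image_of_contConvAt {ι : Type*} {l : Filter ι} [NeBot l] {G : ι → E → E}
    {f : E → E} {U : Set E} (hU : IsOpen U)
    (hG : ∀ z ∈ U, ∀ᶠ q in l ×ˢ 𝓝 z, DifferentiableAt ℂ (G q.1) q.2)
    (h : ∀ z ∈ U, ContConvAt G l f z) {z : E} (hz : z ∈ U) (hdet : (fderiv ℂ f z).det ≠ 0) :
    ∃ ε > 0, Metric.closedBall z ε ⊆ U ∧
      ∃ δ > 0, ∀ᶠ i in l, Metric.ball (f z) δ ⊆ G i '' Metric.closedBall z ε := by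
  have : CompleteSpace E := FiniteDimensional.complete ℂ E
  set A : E ≃L[ℂ] E := (fderiv ℂ f z).toContinuousLinearEquivOfDetNeZero hdet with hA
  have hAf : (A : E →L[ℂ] E) = fderiv ℂ f z := by
    ext; rfl
  set R := A.toNonlinearRightInverse
  rcases subsingleton_or_nontrivial E with hE | hE
  · obtain ⟨ε, hε, hεU⟩ := Metric.nhds_basis_closedBall.mem_iff.1 (hU.mem_nhds hz)
    exact ⟨ε, hε, hεU, 1, one_pos, Eventually.of_forall fun i y _ =>
      ⟨z, Metric.mem_closedBall_self hε.le, Subsingleton.elim _ _⟩⟩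
  have hRpos : 0 < (R.nnnorm : ℝ) := A.norm_symm_pos
  set c : NNReal := R.nnnorm⁻¹ / 2 with hc
  have hcR : (c : ℝ) = (R.nnnorm : ℝ)⁻¹ / 2 := by simp [hc]
  have hcpos : (0 : ℝ) < c := by rw [hcR]; positivity
  have hconv := contConvAt_fderiv hU hG h hz
  have hev := (Metric.tendsto_nhds.1 hconv c hcpos).and (hG z hz)
  obtain ⟨pa, hpa, pb, hpb, hab⟩ := eventually_prod_iff.1 hev
  obtain ⟨ε, hε, hεU⟩ := Metric.nhds_basis_closedBall.mem_iff.1 (inter_mem (hU.mem_nhds hz) hpb)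
  refine ⟨ε, hε, fun w hw => (hεU hw).1, c * ε / 2, by positivity, ?_⟩
  filter_upwards [hpa, Metric.tendsto_nhds.1 (h z hz).tendsto (c * ε / 2) (by positivity)]
    with i hi hi2 y hy
  have happ : ApproximatesLinearOn (G i) (A : E →L[ℂ] E) (Metric.closedBall z ε) c := by
    intro x hx y hy
    refine (convex_closedBall z ε).norm_image_sub_le_of_norm_hasFDerivWithin_le' (𝕜 := ℂ)
      (f' := fderiv ℂ (G i)) (fun w hw => ?_) (fun w hw => ?_) hy hx
    · exact (hab hi (hεU hw).2).2.hasFDerivAt.hasFDerivWithinAt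
    · rw [hAf, ← dist_eq_norm]
      exact (hab hi (hεU hw).2).1.le
  have hsurj := happ.surjOn_closedBall_of_nonlinearRightInverse R hε.le subset_rfl
  refine hsurj ?_
  rw [Metric.mem_closedBall]
  have h1 := Metric.mem_ball.1 hy
  have h2 := dist_triangle_right y (G i z) (f z)
  have h3 : ((R.nnnorm : ℝ)⁻¹ - c) * ε = c * ε := by rw [hcR]; ring
  rw [h3]
  linarith

end Jacobian

/-! ### Convergence of bounded domains -/

section Domains

lemma IsPreconnected.subset_of_frontier_disjoint {α : Type*} [TopologicalSpace α] {K S : Set α}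
    (hK : IsPreconnected K) (hS : IsOpen S) (hKS : (K ∩ S).Nonempty)
    (hfr : ∀ x ∈ K, x ∉ frontier S) : K ⊆ S := by
  refine hK.subset_of_closure_inter_subset hS hKS ?_
  rintro x ⟨hxS, hxK⟩
  rw [closure_eq_self_union_frontier] at hxS
  exact hxS.resolve_right (hfr x hxK)

variable {n : ℕ} {D : Set (EuclideanSpace ℂ (Fin n))}

lemma IsBoundedDomain.frontier_nonempty [Nontrivial (EuclideanSpace ℂ (Fin n))]
    (hD : IsBoundedDomain D) : (frontier D).Nonempty := by
  refine nonempty_frontier_iff.2 ⟨hD.isConnected.nonempty, fun h => ?_⟩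
  exact NormedSpace.unbounded_univ ℂ (EuclideanSpace ℂ (Fin n)) (h ▸ hD.isBounded)

lemma IsBoundedDomain.isBounded_frontier (hD : IsBoundedDomain D) :
    Bornology.IsBounded (frontier D) :=
  hD.isBounded.closure.subset frontier_subset_closure

/-- A bounded open set lies in every ball around the origin that contains its boundary: a ray
leaving the ball would have to cross the boundary. -/
lemma IsBoundedDomain.subset_closedBall (hD : IsBoundedDomain D) {R : ℝ} (hR : 0 ≤ R)
    (hfr : frontier D ⊆ Metric.closedBall 0 R) : D ⊆ Metric.closedBall 0 R := by
  intro z hz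
  by_contra hzR
  rw [mem_closedBall_zero_iff, not_le] at hzR
  have hz0 : 0 < ‖z‖ := hR.trans_lt hzR
  have hray : IsPreconnected ((fun s : ℝ => s • z) '' Ici 1) :=
    isPreconnected_Ici.image _ (by fun_prop : Continuous fun s : ℝ => s • z).continuousOn
  have hsub := hray.subset_of_frontier_disjoint hD.isOpen ⟨z, ⟨1, by simp, by simp⟩, hz⟩ (by
    rintro _ ⟨s, hs, rfl⟩ hx
    have h1 := mem_closedBall_zero_iff.1 (hfr hx)
    have h2 : (1 : ℝ) ≤ s := hs
    rw [norm_smul, Real.norm_of_nonneg (by linarith)] at h1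
    nlinarith)
  obtain ⟨C, hC⟩ := hD.isBounded.exists_norm_le
  have h3 := hC _ (hsub ⟨max 1 ((|C| + 1) / ‖z‖), mem_Ici.2 (le_max_left _ _), rfl⟩)
  rw [norm_smul, Real.norm_of_nonneg (by positivity)] at h3
  have h4 : (|C| + 1) / ‖z‖ * ‖z‖ ≤ max 1 ((|C| + 1) / ‖z‖) * ‖z‖ := by
    gcongr
    exact le_max_right _ _
  rw [div_mul_cancel₀ _ hz0.ne'] at h4
  linarith [le_abs_self C]

variable {Dseq : ℕ → Set (EuclideanSpace ℂ (Fin n))}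
  [Nontrivial (EuclideanSpace ℂ (Fin n))]
  (hDseq : ∀ j, IsBoundedDomain (Dseq j)) (hD : IsBoundedDomain D)
  (hlim : Tendsto (fun j => boundaryDist (Dseq j) D) atTop (𝓝 0))

include hDseq hD hlim

lemma eventually_frontier_near {δ : ℝ} (hδ : 0 < δ) :
    ∀ᶠ j in atTop, (∀ x ∈ frontier (Dseq j), ∃ y ∈ frontier D, dist x y < δ) ∧
      ∀ y ∈ frontier D, ∃ x ∈ frontier (Dseq j), dist x y < δ := by
  filter_upwards [hlim.eventually_lt_const hδ] with j hj
  have hfin := Metric.hausdorffEDist_ne_top_of_nonempty_of_bounded (hDseq j).frontier_nonempty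
    hD.frontier_nonempty (hDseq j).isBounded_frontier hD.isBounded_frontier
  exact ⟨fun x hx => Metric.exists_dist_lt_of_hausdorffDist_lt hx hj hfin,
    fun y hy => Metric.exists_dist_lt_of_hausdorffDist_lt' hy hj hfin⟩

lemma exists_eventually_subset_closedBall :
    ∃ R : ℝ, 0 < R ∧ ∀ᶠ j in atTop, Dseq j ⊆ Metric.closedBall 0 R := by
  obtain ⟨C, hC0, hC⟩ := hD.isBounded_frontier.exists_pos_norm_le
  refine ⟨C + 1, by positivity, ?_⟩
  filter_upwards [eventually_frontier_near hDseq hD hlim one_pos] with j hj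
  refine (hDseq j).subset_closedBall (by positivity) fun x hx => ?_
  obtain ⟨y, hy, hxy⟩ := hj.1 x hx
  rw [mem_closedBall_zero_iff]
  have := norm_le_norm_add_norm_sub' x y
  rw [dist_eq_norm] at hxy
  linarith [hC y hy]

/-- Boundary points of the limit domain are limits of points outside the approximating domains. -/
lemma eventually_exists_notMem {q : EuclideanSpace ℂ (Fin n)} (hq : q ∈ frontier D) {δ : ℝ}
    (hδ : 0 < δ) : ∀ᶠ j in atTop, ∃ x ∈ Metric.ball q δ, x ∉ Dseq j := by
  filter_upwards [eventually_frontier_near hDseq hD hlim hδ] with j hj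
  obtain ⟨x, hx, hxq⟩ := hj.2 q hq
  exact ⟨x, hxq, fun hxD => (disjoint_frontier_iff_isOpen.2 (hDseq j).isOpen).le_bot ⟨hx, hxD⟩⟩

lemma ball_subset_of_forall_ball_subset {p : EuclideanSpace ℂ (Fin n)} {ρ : ℝ} (hρ : 0 < ρ)
    (hp : p ∈ D) (hball : ∀ j, Metric.ball p ρ ⊆ Dseq j) : Metric.ball p ρ ⊆ D := by
  refine (convex_ball p ρ).isPreconnected.subset_of_frontier_disjoint hD.isOpen
    ⟨p, Metric.mem_ball_self hρ, hp⟩ fun q hq hqf => ?_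
  obtain ⟨δ, hδ, hδs⟩ := Metric.isOpen_iff.1 Metric.isOpen_ball q hq
  obtain ⟨j, x, hx, hxD⟩ := (eventually_exists_notMem hDseq hD hlim hqf hδ).exists
  exact hxD (hball j (hδs hx))

/-- Locally uniformly, points of the limit domain belong to the approximating domains: a compact
connected subset of `D` through `p` eventually avoids the boundaries. -/
lemma eventually_mem_nhds {p : EuclideanSpace ℂ (Fin n)} (hp : p ∈ D) (hpj : ∀ j, p ∈ Dseq j)
    {z : EuclideanSpace ℂ (Fin n)} (hz : z ∈ D) :
    ∀ᶠ q in atTop ×ˢ 𝓝 z, q.2 ∈ Dseq q.1 := by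
  obtain ⟨γ, hγ⟩ := (hD.isOpen.isConnected_iff_isPathConnected.1 hD.isConnected).joinedIn p hp z hz
  obtain ⟨ε, hε, hεD⟩ := Metric.nhds_basis_closedBall.mem_iff.1 (hD.isOpen.mem_nhds hz)
  set K := range γ ∪ Metric.closedBall z ε with hK
  have hKc : IsCompact K := (isCompact_range γ.continuous).union (isCompact_closedBall z ε)
  have hKp : IsPreconnected K :=
    (isPreconnected_range γ.continuous).union z ⟨1, by simp⟩ (Metric.mem_closedBall_self hε.le)
      (convex_closedBall z ε).isPreconnected
  have hKD : K ⊆ D := union_subset (range_subset_iff.2 hγ) hεD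
  obtain ⟨δ, hδ, hδD⟩ := hKc.exists_thickening_subset_open hD.isOpen hKD
  have hev : ∀ᶠ j in atTop, K ⊆ Dseq j := by
    filter_upwards [eventually_frontier_near hDseq hD hlim hδ] with j hj
    refine hKp.subset_of_frontier_disjoint (hDseq j).isOpen
      ⟨p, Or.inl ⟨0, by simp⟩, hpj j⟩ fun x hx hxf => ?_
    obtain ⟨y, hy, hxy⟩ := hj.1 x hxf
    refine (disjoint_frontier_iff_isOpen.2 hD.isOpen).le_bot ⟨hy, hδD ?_⟩
    exact Metric.mem_thickening_iff.2 ⟨x, hx, by rwa [dist_comm]⟩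
  filter_upwards [hev.prod_mk (Metric.closedBall_mem_nhds z hε)] with q hq
  exact hq.1 (Or.inr hq.2)

end Domains

/-! ### Equicontinuity -/

section Equicontinuity

/-- Equicontinuity at `z` of the family `F i`, for indices far along `l`. -/
def EquiContAt {ι α β : Type*} [TopologicalSpace α] [PseudoMetricSpace β]
    (F : ι → α → β) (l : Filter ι) (z : α) : Prop :=
  Tendsto (fun q : ι × α => dist (F q.1 q.2) (F q.1 z)) (l ×ˢ 𝓝 z) (𝓝 0)

variable {ι α β : Type*} [TopologicalSpace α] [PseudoMetricSpace β]
  {F : ι → α → β} {l : Filter ι} {f : α → β}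

lemma EquiContAt.mono {z : α} {l' : Filter ι} (h : EquiContAt F l z) (hl : l' ≤ l) :
    EquiContAt F l' z :=
  Tendsto.mono_left h (prod_mono hl le_rfl)

lemma EquiContAt.contConvAt {z : α} (h : EquiContAt F l z)
    (hz : Tendsto (fun i => F i z) l (𝓝 (f z))) : ContConvAt F l f z := by
  rw [ContConvAt, tendsto_iff_dist_tendsto_zero]
  have h1 : Tendsto (fun q : ι × α => dist (F q.1 q.2) (F q.1 z) + dist (F q.1 z) (f z))
      (l ×ˢ 𝓝 z) (𝓝 (0 + 0)) :=
    Tendsto.add h ((tendsto_iff_dist_tendsto_zero.1 hz).comp tendsto_fst)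
  rw [add_zero] at h1
  exact squeeze_zero (fun _ => dist_nonneg) (fun _ => dist_triangle _ _ _) h1

/-- A version of the **Arzelà–Ascoli theorem**, for maps whose good behaviour near a point is only
required far along the sequence. -/
lemma exists_subseq_contConvAt {α β : Type*} [TopologicalSpace α]
    [TopologicalSpace.SeparableSpace α] [Nonempty α] [MetricSpace β] [CompleteSpace β]
    {F : ℕ → α → β} {S : Set α} (hS : IsOpen S) {K : Set β} (hK : IsCompact K)
    (hKne : K.Nonempty) (hF : ∀ y ∈ S, ∀ᶠ j in atTop, F j y ∈ K)
    (he : ∀ y ∈ S, EquiContAt F atTop y) :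
    ∃ φ : ℕ → ℕ, StrictMono φ ∧ ∃ f : α → β, ∀ y ∈ S, ContConvAt F (map φ atTop) f y := by
  classical
  obtain ⟨k₀, hk₀⟩ := hKne
  have : Nonempty β := ⟨k₀⟩
  set u := TopologicalSpace.denseSeq α
  set x : ℕ → ℕ → β := fun j m => if F j (u m) ∈ K then F j (u m) else k₀ with hx
  have hxK : ∀ j, x j ∈ Set.pi univ (fun _ : ℕ => K) := by
    intro j m _
    simp only [hx]
    split_ifs with h
    · exact h
    · exact hk₀
  obtain ⟨y, -, φ, hφ, hy⟩ := (isCompact_univ_pi fun _ : ℕ => hK).tendsto_subseq hxK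
  rw [tendsto_pi_nhds] at hy
  have hdense : ∀ m, u m ∈ S → Tendsto (fun k => F (φ k) (u m)) atTop (𝓝 (y m)) := by
    intro m hm
    refine (hy m).congr' ?_
    filter_upwards [hφ.tendsto_atTop.eventually (hF _ hm)] with k hk
    simp [hx, hk]
  have hlim : ∀ z ∈ S, ∃ b, Tendsto (fun k => F (φ k) z) atTop (𝓝 b) := by
    intro z hz
    refine cauchySeq_tendsto_of_complete (Metric.cauchySeq_iff'.2 fun ε hε => ?_)
    obtain ⟨pa, hpa, pb, hpb, hab⟩ := eventually_prod_iff.1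
      ((he z hz).eventually_lt_const (show (0 : ℝ) < ε / 4 by positivity))
    obtain ⟨V, hVsub, hVo, hzV⟩ := mem_nhds_iff.1 (inter_mem (hS.mem_nhds hz) hpb)
    obtain ⟨m, hm⟩ := (TopologicalSpace.denseRange_denseSeq α).exists_mem_open hVo ⟨z, hzV⟩
    have h1 := Metric.tendsto_nhds.1 (hdense m (hVsub hm).1) (ε / 4) (by positivity)
    obtain ⟨N, hN⟩ := eventually_atTop.1 ((hφ.tendsto_atTop.eventually hpa).and h1)
    refine ⟨N, fun k hk => ?_⟩
    have ha := hab (hN k hk).1 (hVsub hm).2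
    have hb := hab (hN N le_rfl).1 (hVsub hm).2
    have hc := (hN k hk).2
    have hd := (hN N le_rfl).2
    simp only at ha hb
    have t1 := dist_triangle_left (F (φ k) z) (F (φ N) z) (F (φ k) (u m))
    have t2 := dist_triangle (F (φ k) (u m)) (F (φ N) (u m)) (F (φ N) z)
    have t3 := dist_triangle_right (F (φ k) (u m)) (F (φ N) (u m)) (y m)
    linarith
  choose! f hf using hlim
  exact ⟨φ, hφ, f, fun z hz =>
    ((he z hz).mono hφ.tendsto_atTop).contConvAt (tendsto_map'_iff.2 (hf z hz))⟩

end Equicontinuity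

/-! ### One-parameter groups and their generators -/

section SingleGroup

variable {n : ℕ} {D : Set (EuclideanSpace ℂ (Fin n))}
  {g : EuclideanSpace ℂ (Fin n) → ℝ → EuclideanSpace ℂ (Fin n)}
  {X : EuclideanSpace ℂ (Fin n) → EuclideanSpace ℂ (Fin n)}

lemma IsOneParameterGroup.hasDerivAt (hg : IsOneParameterGroup D g) (hX : IsGenerator D g X)
    {z : EuclideanSpace ℂ (Fin n)} (hz : z ∈ D) (t : ℝ) :
    HasDerivAt (fun s : ℝ => g z s) (X (g z t)) t := by
  have h := hX (g z t) (hg.mapsTo t hz)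
  rw [← sub_self t] at h
  refine (h.comp_sub_const t t).congr_of_eventuallyEq (Eventually.of_forall fun s => ?_)
  have := hg.add z hz t (s - t)
  rwa [add_sub_cancel] at this

/-- The generator is invariant under its flow. -/
lemma IsOneParameterGroup.generator_apply (hD : IsOpen D) (hg : IsOneParameterGroup D g)
    (hX : IsGenerator D g X) {z : EuclideanSpace ℂ (Fin n)} (hz : z ∈ D) (s : ℝ) :
    X (g z s) = fderiv ℂ (fun w => g w s) z (X z) := by
  have hf : HasFDerivAt (fun w => g w s) (fderiv ℂ (fun w => g w s) z) (g z 0) := by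
    rw [hg.zero z hz]
    exact ((hg.holomorphic s).differentiableAt (hD.mem_nhds hz)).hasFDerivAt
  have h1 := (hf.restrictScalars ℝ).comp_hasDerivAt (0 : ℝ) (hX z hz)
  refine (hX (g z s) (hg.mapsTo s hz)).unique (h1.congr_of_eventuallyEq
    (Eventually.of_forall fun t => ?_))
  simp only [Function.comp_apply]
  rw [← hg.add z hz, ← hg.add z hz, add_comm]

/-- A curve whose speed is at most `1` while it is inside `ball p r`, and which starts well inside
that ball, moves with speed at most `2` for a short time: it cannot reach the sphere before. -/
lemma norm_sub_le_of_speed_le {E : Type*} [NormedAddCommGroup E] [NormedSpace ℝ E] {p z : E}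
    {r : ℝ} {γ γ' : ℝ → E} (h0 : γ 0 = z) (hγ : ∀ s, HasDerivAt γ (γ' s) s)
    (hb : ∀ s, γ s ∈ Metric.ball p r → ‖γ' s‖ ≤ 1) (hz : z ∈ Metric.ball p (r / 2)) {t : ℝ}
    (ht : t ∈ Icc 0 (r / 8)) : ‖γ t - z‖ ≤ 2 * t := by
  -- The constant `2 > 1` makes the fencing inequality strict.
  refine image_norm_le_of_norm_deriv_right_lt_deriv_boundary (f := fun s => γ s - z) (f' := γ')
    (B := fun s => 2 * s) (B' := fun _ => 2) (a := 0) (b := r / 8) ?_ ?_ ?_ ?_ ?_ ht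
  · exact fun s _ => ((hγ s).sub_const z).continuousAt.continuousWithinAt
  · exact fun s _ => ((hγ s).sub_const z).hasDerivWithinAt
  · simp [h0]
  · intro s
    simpa using (hasDerivAt_id s).const_mul 2
  · intro s hs hns
    refine (hb s ?_).trans_lt one_lt_two
    rw [mem_ball_iff_norm] at hz ⊢
    have h1 : ‖γ s - p‖ ≤ ‖γ s - z‖ + ‖z - p‖ := norm_sub_le_norm_sub_add_norm_sub _ _ _
    have h2 := hs.2
    have h4 := hs.1
    have h3 : ‖γ s - z‖ = 2 * s := hns
    linarith

lemma IsOneParameterGroup.norm_sub_le (hg : IsOneParameterGroup D g) (hX : IsGenerator D g X)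
    {p : EuclideanSpace ℂ (Fin n)} {r : ℝ} (hr : 0 < r) (hball : Metric.ball p r ⊆ D)
    (hX1 : ∀ z ∈ Metric.ball p r, ‖X z‖ ≤ 1) {z : EuclideanSpace ℂ (Fin n)}
    (hz : z ∈ Metric.ball p (r / 2)) {t : ℝ} (ht : |t| ≤ r / 8) : ‖g z t - z‖ ≤ 2 * |t| := by
  have hzD : z ∈ D := hball (Metric.ball_subset_ball (by linarith) hz)
  rcases le_total 0 t with h | h
  · rw [abs_of_nonneg h] at ht ⊢
    exact norm_sub_le_of_speed_le (γ := fun s => g z s) (hg.zero z hzD)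
      (fun s => hg.hasDerivAt hX hzD s) (fun s hs => hX1 _ hs) hz ⟨h, ht⟩
  · rw [abs_of_nonpos h] at ht ⊢
    have := norm_sub_le_of_speed_le (γ := fun s => g z (-s)) (γ' := fun s => -X (g z (-s)))
      (by simpa using hg.zero z hzD) (fun s => ?_)
      (fun s hs => by rw [norm_neg]; exact hX1 _ hs) hz
      (t := -t) ⟨by linarith, ht⟩
    · simpa using this
    · have := (hg.hasDerivAt hX hzD (-s)).scomp s (hasDerivAt_neg s)
      simpa [Function.comp_def] using this

lemma IsOneParameterGroup.det_fderiv_ne_zero (hD : IsOpen D) (hg : IsOneParameterGroup D g)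
    {z : EuclideanSpace ℂ (Fin n)} (hz : z ∈ D) (t : ℝ) :
    (fderiv ℂ (fun w => g w t) z).det ≠ 0 := by
  have h1 := ((hg.holomorphic t).differentiableAt (hD.mem_nhds hz)).hasFDerivAt
  have h2 := ((hg.holomorphic (-t)).differentiableAt
    (hD.mem_nhds (hg.mapsTo t hz))).hasFDerivAt
  have h3 := h2.comp z h1
  have h4 : HasFDerivAt ((fun w => g w (-t)) ∘ fun w => g w t)
      (ContinuousLinearMap.id ℂ (EuclideanSpace ℂ (Fin n))) z := by
    refine (hasFDerivAt_id z).congr_of_eventuallyEq ?_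
    filter_upwards [hD.mem_nhds hz] with w hw
    simp only [Function.comp_apply, id]
    rw [← hg.add w hw, add_neg_cancel, hg.zero w hw]
  have h5 := congrArg ContinuousLinearMap.det (h3.unique h4)
  intro h0
  simp only [ContinuousLinearMap.det, ContinuousLinearMap.toLinearMap_comp, LinearMap.det_comp]
    at h5 h0
  rw [h0, mul_zero] at h5
  simp at h5

end SingleGroup

/-! ### Sequences of one-parameter groups on uniformly bounded domains -/

section BoundedFlows

/-- One-parameter groups `g j` on open sets `Dseq j` that eventually lie in a fixed ball and
locally uniformly exhaust the open set `D`. -/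
structure IsBoundedFlowSeq {n : ℕ} (Dseq : ℕ → Set (EuclideanSpace ℂ (Fin n)))
    (g : ℕ → EuclideanSpace ℂ (Fin n) → ℝ → EuclideanSpace ℂ (Fin n))
    (D : Set (EuclideanSpace ℂ (Fin n))) (R : ℝ) : Prop where
  isOpen : IsOpen D
  isOpen_seq : ∀ j, IsOpen (Dseq j)
  isOneParameterGroup : ∀ j, IsOneParameterGroup (Dseq j) (g j)
  eventually_mem : ∀ z ∈ D, ∀ᶠ q in atTop ×ˢ 𝓝 z, q.2 ∈ Dseq q.1
  eventually_subset : ∀ᶠ j in atTop, Dseq j ⊆ Metric.closedBall 0 R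

variable {n : ℕ} {Dseq : ℕ → Set (EuclideanSpace ℂ (Fin n))} {D : Set (EuclideanSpace ℂ (Fin n))}
  {g : ℕ → EuclideanSpace ℂ (Fin n) → ℝ → EuclideanSpace ℂ (Fin n)} {R : ℝ}

namespace IsBoundedFlowSeq

lemma eventually_mem_const (h : IsBoundedFlowSeq Dseq g D R) {z : EuclideanSpace ℂ (Fin n)}
    (hz : z ∈ D) : ∀ᶠ j in atTop, z ∈ Dseq j :=
  (tendsto_id.prodMk (tendsto_const_nhds (x := z))).eventually (h.eventually_mem z hz)

lemma eventually_subset_of_isCompact (h : IsBoundedFlowSeq Dseq g D R)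
    {K : Set (EuclideanSpace ℂ (Fin n))} (hK : IsCompact K) (hKD : K ⊆ D) :
    ∀ᶠ j in atTop, K ⊆ Dseq j :=
  eventually_forall_mem_of_isCompact (P := fun j z => z ∈ Dseq j) hK
    fun z hz => h.eventually_mem z (hKD hz)

lemma eventually_differentiableAt (h : IsBoundedFlowSeq Dseq g D R)
    {z : EuclideanSpace ℂ (Fin n)} (hz : z ∈ D) :
    ∀ᶠ m : (ℕ × ℝ) × EuclideanSpace ℂ (Fin n) in (atTop ×ˢ ⊤) ×ˢ 𝓝 z,
      DifferentiableAt ℂ (fun w => g m.1.1 w m.1.2) m.2 := by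
  have ht : Tendsto (fun m : (ℕ × ℝ) × EuclideanSpace ℂ (Fin n) => (m.1.1, m.2))
      ((atTop ×ˢ ⊤) ×ˢ 𝓝 z) (atTop ×ˢ 𝓝 z) :=
    (tendsto_fst.comp tendsto_fst).prodMk tendsto_snd
  filter_upwards [ht.eventually (h.eventually_mem z hz)] with m hm
  exact ((h.isOneParameterGroup m.1.1).holomorphic m.1.2).differentiableAt
    ((h.isOpen_seq m.1.1).mem_nhds hm)

/-- By Cauchy's estimates the maps `g j (·, t)` are equicontinuous, uniformly in all times `t`. -/
lemma equiContAt_space (h : IsBoundedFlowSeq Dseq g D R) {z : EuclideanSpace ℂ (Fin n)}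
    (hz : z ∈ D) :
    EquiContAt (fun (m : ℕ × ℝ) w => g m.1 w m.2) (atTop ×ˢ ⊤) z := by
  obtain ⟨ρ, hρ, hρD⟩ := Metric.nhds_basis_closedBall.mem_iff.1 (h.isOpen.mem_nhds hz)
  have hev := (h.eventually_subset_of_isCompact (isCompact_closedBall z ρ) hρD).and
    h.eventually_subset
  have hbound : ∀ᶠ m : (ℕ × ℝ) × EuclideanSpace ℂ (Fin n) in (atTop ×ˢ ⊤) ×ˢ 𝓝 z,
      dist (g m.1.1 m.2 m.1.2) (g m.1.1 z m.1.2) ≤ 2 * R / (ρ / 2) * dist m.2 z := by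
    have hb := Metric.ball_mem_nhds z (show 0 < ρ / 2 by positivity)
    filter_upwards [(hev.prod_inl ⊤).prod_mk hb] with m hm
    obtain ⟨⟨hm1, hm2⟩, hm3⟩ := hm
    have hsub : Metric.ball z (2 * (ρ / 2)) ⊆ Dseq m.1.1 := by
      rw [mul_div_cancel₀ _ two_ne_zero]
      exact Metric.ball_subset_closedBall.trans hm1
    rw [dist_eq_norm, dist_eq_norm]
    exact norm_sub_le_of_forall_mem_ball (by positivity)
      (((h.isOneParameterGroup m.1.1).holomorphic m.1.2).mono hsub)
      (fun w hw => mem_closedBall_zero_iff.1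
        (hm2 ((h.isOneParameterGroup m.1.1).mapsTo m.1.2 (hsub hw))))
      (Metric.mem_ball_self (by positivity)) hm3
  refine squeeze_zero' (Eventually.of_forall fun _ => dist_nonneg) hbound ?_
  have hd : Tendsto (fun m : (ℕ × ℝ) × EuclideanSpace ℂ (Fin n) => dist m.2 z)
      ((atTop ×ˢ ⊤) ×ˢ 𝓝 z) (𝓝 0) :=
    (tendsto_iff_dist_tendsto_zero.1 tendsto_id).comp tendsto_snd
  simpa using hd.const_mul (2 * R / (ρ / 2))

/-- If the maps `g j (·, t)` tend to the identity near one point of `D` as `j → ∞` and `t → 0`,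
then they do so locally uniformly on all of `D`. By Montel's theorem, every ultrafilter limit of
these maps is holomorphic on `D`, hence is the identity by the identity theorem. -/
lemma contConvAt_id (h : IsBoundedFlowSeq Dseq g D R) (hDc : IsPreconnected D)
    {p : EuclideanSpace ℂ (Fin n)} (hp : p ∈ D)
    (h0 : ∀ᶠ w in 𝓝 p, Tendsto (fun m : ℕ × ℝ => g m.1 w m.2) (atTop ×ˢ 𝓝 0) (𝓝 w))
    {z : EuclideanSpace ℂ (Fin n)} (hz : z ∈ D) :
    ContConvAt (fun (m : ℕ × ℝ) w => g m.1 w m.2) (atTop ×ˢ 𝓝 0) id z := by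
  have hle : (atTop ×ˢ 𝓝 0 : Filter (ℕ × ℝ)) ≤ atTop ×ˢ ⊤ := prod_mono le_rfl le_top
  refine ((h.equiContAt_space hz).mono hle).contConvAt (tendsto_iff_ultrafilter _ _ _ |>.2
    fun 𝓤 h𝓤 => ?_)
  have hlim : ∀ w ∈ D, ∃ y, Tendsto (fun m : ℕ × ℝ => g m.1 w m.2) 𝓤 (𝓝 y) := by
    intro w hw
    have hev : ∀ᶠ m : ℕ × ℝ in 𝓤, g m.1 w m.2 ∈ Metric.closedBall 0 R := by
      refine (h𝓤.trans hle) ?_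
      filter_upwards [((h.eventually_mem_const hw).and h.eventually_subset).prod_inl ⊤] with m hm
      exact hm.2 ((h.isOneParameterGroup m.1).mapsTo m.2 hm.1)
    obtain ⟨y, -, hy⟩ := (isCompact_closedBall (0 : EuclideanSpace ℂ (Fin n)) R).ultrafilter_le_nhds'
      (𝓤.map fun m : ℕ × ℝ => g m.1 w m.2) hev
    exact ⟨y, hy⟩
  choose! f hf using hlim
  have hconv : ∀ w ∈ D, ContConvAt (fun (m : ℕ × ℝ) w => g m.1 w m.2) 𝓤 f w := fun w hw =>
    ((h.equiContAt_space hw).mono (h𝓤.trans hle)).contConvAt (hf w hw)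
  have hfd : DifferentiableOn ℂ f D := fun w hw =>
    (differentiableAt_of_contConvAt h.isOpen (fun w hw => (h.eventually_differentiableAt hw).filter_mono
      (prod_mono (h𝓤.trans hle) le_rfl)) hconv hw).differentiableWithinAt
  have hzero : f z - z = 0 := by
    refine eqOn_zero_of_eventually_eq_zero (f := fun w => f w - w) h.isOpen hDc
      (hfd.sub differentiableOn_id) hp ?_ hz
    filter_upwards [h0, h.isOpen.mem_nhds hp] with w hw hwD
    rw [tendsto_nhds_unique (hf w hwD) (hw.mono_left h𝓤), sub_self]
  have := hf z hz
  rwa [sub_eq_zero.1 hzero] at this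

/-- Joint equicontinuity in space and time: write `g j (w, s) = g j (g j (w, s - t), t)`. -/
lemma equiContAt_spaceTime (h : IsBoundedFlowSeq Dseq g D R)
    (hid : ∀ z ∈ D, ContConvAt (fun (m : ℕ × ℝ) w => g m.1 w m.2) (atTop ×ˢ 𝓝 0) id z)
    {z : EuclideanSpace ℂ (Fin n)} (hz : z ∈ D) (t : ℝ) :
    EquiContAt (fun j (q : EuclideanSpace ℂ (Fin n) × ℝ) => g j q.1 q.2) atTop (z, t) := by
  have h1 : Tendsto (fun m : ℕ × EuclideanSpace ℂ (Fin n) × ℝ => ((m.1, m.2.2 - t), m.2.1))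
      (atTop ×ˢ 𝓝 (z, t)) ((atTop ×ˢ 𝓝 0) ×ˢ 𝓝 z) := by
    have hsub : Tendsto (fun m : ℕ × EuclideanSpace ℂ (Fin n) × ℝ => m.2.2 - t)
        (atTop ×ˢ 𝓝 (z, t)) (𝓝 0) := by
      have : Tendsto (fun q : EuclideanSpace ℂ (Fin n) × ℝ => q.2 - t) (𝓝 (z, t)) (𝓝 (t - t)) :=
        (by fun_prop : Continuous fun q : EuclideanSpace ℂ (Fin n) × ℝ => q.2 - t).tendsto _
      rw [sub_self] at this
      exact this.comp tendsto_snd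
    exact (tendsto_fst.prodMk hsub).prodMk ((continuous_fst.tendsto _).comp tendsto_snd)
  have h2 : Tendsto (fun m : ℕ × EuclideanSpace ℂ (Fin n) × ℝ => g m.1 m.2.1 (m.2.2 - t))
      (atTop ×ˢ 𝓝 (z, t)) (𝓝 z) := Tendsto.comp (hid z hz) h1
  have h3 : Tendsto (fun m : ℕ × EuclideanSpace ℂ (Fin n) × ℝ =>
      ((m.1, t), g m.1 m.2.1 (m.2.2 - t))) (atTop ×ˢ 𝓝 (z, t)) ((atTop ×ˢ ⊤) ×ˢ 𝓝 z) :=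
    (tendsto_fst.prodMk tendsto_top).prodMk h2
  refine (Tendsto.comp (h.equiContAt_space hz) h3).congr' ?_
  have h4 : Tendsto (fun m : ℕ × EuclideanSpace ℂ (Fin n) × ℝ => (m.1, m.2.1))
      (atTop ×ˢ 𝓝 (z, t)) (atTop ×ˢ 𝓝 z) :=
    tendsto_fst.prodMk ((continuous_fst.tendsto _).comp tendsto_snd)
  filter_upwards [h4.eventually (h.eventually_mem z hz)] with m hm
  simp only [Function.comp_apply]
  rw [← (h.isOneParameterGroup m.1).add _ hm, sub_add_cancel]

/-- Normal families: a subsequence converges locally uniformly on `D × ℝ`. -/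
lemma exists_subseq (h : IsBoundedFlowSeq Dseq g D R) (hR : 0 ≤ R)
    (hid : ∀ z ∈ D, ContConvAt (fun (m : ℕ × ℝ) w => g m.1 w m.2) (atTop ×ˢ 𝓝 0) id z) :
    ∃ φ : ℕ → ℕ, StrictMono φ ∧ ∃ G : EuclideanSpace ℂ (Fin n) × ℝ → EuclideanSpace ℂ (Fin n),
      ∀ q ∈ D ×ˢ (univ : Set ℝ), ContConvAt
        (fun j (q : EuclideanSpace ℂ (Fin n) × ℝ) => g j q.1 q.2) (map φ atTop) G q := by
  refine exists_subseq_contConvAt (h.isOpen.prod isOpen_univ)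
    (isCompact_closedBall (0 : EuclideanSpace ℂ (Fin n)) R) ⟨0, Metric.mem_closedBall_self hR⟩ ?_
    fun q hq => h.equiContAt_spaceTime hid hq.1 q.2
  intro q hq
  filter_upwards [h.eventually_mem_const hq.1, h.eventually_subset] with j h1 h2
  exact h2 ((h.isOneParameterGroup j).mapsTo q.2 h1)

end IsBoundedFlowSeq

end BoundedFlows

/-! ### The limit group -/

section LimitFlow

variable {n : ℕ} {Dseq : ℕ → Set (EuclideanSpace ℂ (Fin n))} {D : Set (EuclideanSpace ℂ (Fin n))}
  {g : ℕ → EuclideanSpace ℂ (Fin n) → ℝ → EuclideanSpace ℂ (Fin n)} {R : ℝ}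
  {l : Filter ℕ} {G : EuclideanSpace ℂ (Fin n) × ℝ → EuclideanSpace ℂ (Fin n)}

lemma contConvAt_slice {z : EuclideanSpace ℂ (Fin n)} {t : ℝ}
    (hG : ContConvAt (fun j (q : EuclideanSpace ℂ (Fin n) × ℝ) => g j q.1 q.2) l G (z, t)) :
    ContConvAt (fun j w => g j w t) l (fun w => G (w, t)) z := by
  refine Tendsto.comp hG (?_ : Tendsto (fun m : ℕ × EuclideanSpace ℂ (Fin n) => (m.1, m.2, t))
    (l ×ˢ 𝓝 z) (l ×ˢ 𝓝 (z, t)))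
  exact tendsto_fst.prodMk (tendsto_snd.prodMk_nhds tendsto_const_nhds)

namespace IsBoundedFlowSeq

lemma eventually_differentiableAt_slice (h : IsBoundedFlowSeq Dseq g D R) (hl : l ≤ atTop) (t : ℝ)
    {z : EuclideanSpace ℂ (Fin n)} (hz : z ∈ D) :
    ∀ᶠ m : ℕ × EuclideanSpace ℂ (Fin n) in l ×ˢ 𝓝 z, DifferentiableAt ℂ (fun w => g m.1 w t) m.2 := by
  have ht : Tendsto (fun m : ℕ × EuclideanSpace ℂ (Fin n) => ((m.1, t), m.2)) (l ×ˢ 𝓝 z)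
      ((atTop ×ˢ ⊤) ×ˢ 𝓝 z) :=
    ((tendsto_fst.mono_right hl).prodMk tendsto_top).prodMk tendsto_snd
  exact ht.eventually (h.eventually_differentiableAt hz)

lemma tendsto_fderiv_id (h : IsBoundedFlowSeq Dseq g D R)
    (hid : ∀ z ∈ D, ContConvAt (fun (m : ℕ × ℝ) w => g m.1 w m.2) (atTop ×ˢ 𝓝 0) id z)
    {z : EuclideanSpace ℂ (Fin n)} (hz : z ∈ D) :
    Tendsto (fun m : (ℕ × ℝ) × EuclideanSpace ℂ (Fin n) =>
      fderiv ℂ (fun w => g m.1.1 w m.1.2) m.2) ((atTop ×ˢ 𝓝 0) ×ˢ 𝓝 z)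
      (𝓝 (ContinuousLinearMap.id ℂ (EuclideanSpace ℂ (Fin n)))) := by
  have := contConvAt_fderiv (G := fun (m : ℕ × ℝ) w => g m.1 w m.2) h.isOpen
    (fun w hw => (h.eventually_differentiableAt hw).filter_mono
      (prod_mono (prod_mono le_rfl le_top) le_rfl)) hid hz
  rwa [ContConvAt, fderiv_id] at this

variable [NeBot l]

section

variable (h : IsBoundedFlowSeq Dseq g D R) (hl : l ≤ atTop)
  (hG : ∀ q ∈ D ×ˢ (univ : Set ℝ), ContConvAt
    (fun j (q : EuclideanSpace ℂ (Fin n) × ℝ) => g j q.1 q.2) l G q)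

include h hl hG

lemma limit_zero {z : EuclideanSpace ℂ (Fin n)} (hz : z ∈ D) : G (z, 0) = z := by
  refine tendsto_nhds_unique (hG (z, 0) ⟨hz, mem_univ _⟩).tendsto
    (tendsto_const_nhds.congr' ?_)
  filter_upwards [hl (h.eventually_mem_const hz)] with j hj
  exact ((h.isOneParameterGroup j).zero z hj).symm

lemma limit_add {z : EuclideanSpace ℂ (Fin n)} (hz : z ∈ D) {t : ℝ} (ht : G (z, t) ∈ D) (s : ℝ) :
    G (z, t + s) = G (G (z, t), s) := by
  refine tendsto_nhds_unique (hG (z, t + s) ⟨hz, mem_univ _⟩).tendsto ?_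
  have h1 : Tendsto (fun j => (j, g j z t, s)) l (l ×ˢ 𝓝 (G (z, t), s)) :=
    tendsto_id.prodMk ((hG (z, t) ⟨hz, mem_univ _⟩).tendsto.prodMk_nhds tendsto_const_nhds)
  refine (Tendsto.comp (hG (G (z, t), s) ⟨ht, mem_univ _⟩) h1).congr' ?_
  filter_upwards [hl (h.eventually_mem_const hz)] with j hj
  exact ((h.isOneParameterGroup j).add z hj t s).symm

lemma limit_differentiableOn (t : ℝ) : DifferentiableOn ℂ (fun z => G (z, t)) D := fun _ hz =>
  (differentiableAt_of_contConvAt h.isOpen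
    (fun _ hw => h.eventually_differentiableAt_slice hl t hw)
    (fun w hw => contConvAt_slice (hG (w, t) ⟨hw, mem_univ _⟩)) hz).differentiableWithinAt

lemma contConvAt_det_fderiv (t : ℝ) {z : EuclideanSpace ℂ (Fin n)} (hz : z ∈ D) :
    ContConvAt (fun j w => (fderiv ℂ (fun w => g j w t) w).det) l
      (fun w => (fderiv ℂ (fun w => G (w, t)) w).det) z :=
  (ContinuousLinearMap.continuous_det.tendsto _).comp
    (contConvAt_fderiv h.isOpen (fun _ hw => h.eventually_differentiableAt_slice hl t hw)
    (fun w hw => contConvAt_slice (hG (w, t) ⟨hw, mem_univ _⟩)) hz)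

/-- For small times the limit maps are nondegenerate at `p`, hence everywhere by Hurwitz'
theorem. -/
lemma exists_forall_det_fderiv_ne_zero (hDc : IsPreconnected D)
    (hid : ∀ z ∈ D, ContConvAt (fun (m : ℕ × ℝ) w => g m.1 w m.2) (atTop ×ˢ 𝓝 0) id z)
    {p : EuclideanSpace ℂ (Fin n)} (hp : p ∈ D) :
    ∃ τ > 0, ∀ t : ℝ, |t| < τ → ∀ z ∈ D, (fderiv ℂ (fun w => G (w, t)) z).det ≠ 0 := by
  have h1 : Tendsto (fun m : ℕ × ℝ => (fderiv ℂ (fun w => g m.1 w m.2) p).det) (atTop ×ˢ 𝓝 0)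
      (𝓝 1) := by
    have := (ContinuousLinearMap.continuous_det.tendsto _).comp
      ((h.tendsto_fderiv_id hid hp).comp (tendsto_id.prodMk (tendsto_const_nhds (x := p))))
    simpa [Function.comp_def, ContinuousLinearMap.det] using this
  obtain ⟨pa, hpa, pb, hpb, hab⟩ := eventually_prod_iff.1
    (Metric.tendsto_nhds.1 h1 (1 / 2) (by norm_num))
  obtain ⟨τ, hτ, hτb⟩ := Metric.eventually_nhds_iff.1 hpb
  refine ⟨τ, hτ, fun t ht z hz => ?_⟩
  refine ne_zero_of_contConvAt h.isOpen hDc (fun w hw => ?_)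
    (fun w hw => h.contConvAt_det_fderiv hl hG t hw) hp (fun hzero => ?_) hz
  · filter_upwards [(h.eventually_mem w hw).filter_mono (prod_mono hl le_rfl)] with m hm
    exact ⟨(differentiableOn_det_fderiv (h.isOpen_seq m.1)
      ((h.isOneParameterGroup m.1).holomorphic t)).differentiableAt
        ((h.isOpen_seq m.1).mem_nhds hm),
      (h.isOneParameterGroup m.1).det_fderiv_ne_zero (h.isOpen_seq m.1) hm t⟩
  · have h2 := ((h.contConvAt_det_fderiv hl hG t hp).tendsto.dist
      (tendsto_const_nhds (x := (1 : ℂ))))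
    have h3 : ∀ᶠ j in l, dist (fderiv ℂ (fun w => g j w t) p).det 1 ≤ 1 / 2 :=
      hl (hpa.mono fun j hj => (hab hj (hτb (by simpa using ht))).le)
    have h4 := le_of_tendsto h2 h3
    rw [hzero, dist_comm, dist_zero_right, norm_one] at h4
    norm_num at h4

/-- Nondegenerate limit maps do not reach the boundary of `D`: the maps `g j (·, t)` would cover
a fixed ball around a boundary point of `D`, near which there are points outside `Dseq j`. -/
lemma limit_notMem_frontier
    (hfr : ∀ q ∈ frontier D, ∀ δ > 0, ∀ᶠ j in atTop, ∃ x ∈ Metric.ball q δ, x ∉ Dseq j)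
    {z : EuclideanSpace ℂ (Fin n)} (hz : z ∈ D) {t : ℝ}
    (hdet : (fderiv ℂ (fun w => G (w, t)) z).det ≠ 0) : G (z, t) ∉ frontier D := by
  intro hq
  obtain ⟨ε, hε, hεD, δ, hδ, hev⟩ := exists_ball_subset_image_of_contConvAt h.isOpen
    (fun _ hw => h.eventually_differentiableAt_slice hl t hw)
    (fun w hw => contConvAt_slice (hG (w, t) ⟨hw, mem_univ _⟩)) hz hdet
  obtain ⟨j, hj1, ⟨x, hx, hxD⟩, hj3⟩ := (hev.and
    (((hfr _ hq δ hδ).and (h.eventually_subset_of_isCompact (isCompact_closedBall z ε)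
      hεD)).filter_mono hl)).exists
  obtain ⟨w, hw, rfl⟩ := hj1 hx
  exact hxD ((h.isOneParameterGroup j).mapsTo t (hj3 hw))

lemma limit_mapsTo (hDc : IsPreconnected D)
    (hid : ∀ z ∈ D, ContConvAt (fun (m : ℕ × ℝ) w => g m.1 w m.2) (atTop ×ˢ 𝓝 0) id z)
    {p : EuclideanSpace ℂ (Fin n)} (hp : p ∈ D)
    (hfr : ∀ q ∈ frontier D, ∀ δ > 0, ∀ᶠ j in atTop, ∃ x ∈ Metric.ball q δ, x ∉ Dseq j) (t : ℝ) :
    MapsTo (fun z => G (z, t)) D D := by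
  have hcont : ContinuousOn G (D ×ˢ univ) := continuousOn_of_contConvAt hG
  obtain ⟨τ, hτ, hdet⟩ := h.exists_forall_det_fderiv_ne_zero hl hG hDc hid hp
  have hsmall : ∀ u : ℝ, |u| < τ → ∀ z ∈ D, G (z, u) ∈ D := by
    intro u hu z hz
    have hpre : IsPreconnected ((fun s : ℝ => G (z, s)) '' Metric.ball 0 τ) :=
      (convex_ball (0 : ℝ) τ).isPreconnected.image _
        (hcont.comp (by fun_prop) fun s _ => ⟨hz, mem_univ _⟩)
    refine hpre.subset_of_frontier_disjoint h.isOpen ⟨z, ⟨0, Metric.mem_ball_self hτ, ?_⟩, hz⟩ ?_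
      ⟨u, by simpa using hu, rfl⟩
    · exact h.limit_zero hl hG hz
    · rintro _ ⟨s, hs, rfl⟩
      exact h.limit_notMem_frontier hl hG hfr hz (hdet s (by simpa using hs) z hz)
  -- The group law extends this from small times to all multiples of small times.
  intro z hz
  obtain ⟨N, hN⟩ := exists_nat_gt (|t| / τ)
  have hN0 : (0 : ℝ) < N := lt_of_le_of_lt (by positivity) hN
  have hu : |t / N| < τ := by
    rw [abs_div, abs_of_pos hN0, div_lt_iff₀ hN0]
    rwa [div_lt_iff₀ hτ, mul_comm] at hN
  have hmul : ∀ k : ℕ, G (z, k * (t / N)) ∈ D := by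
    intro k
    induction k with
    | zero => simpa [h.limit_zero hl hG hz] using hz
    | succ k ih =>
      rw [Nat.cast_succ, add_mul, one_mul, h.limit_add hl hG hz ih]
      exact hsmall _ hu _ ih
  have := hmul N
  rwa [mul_div_cancel₀ _ hN0.ne'] at this

lemma isOneParameterGroup_limit (hDc : IsPreconnected D)
    (hid : ∀ z ∈ D, ContConvAt (fun (m : ℕ × ℝ) w => g m.1 w m.2) (atTop ×ˢ 𝓝 0) id z)
    {p : EuclideanSpace ℂ (Fin n)} (hp : p ∈ D)
    (hfr : ∀ q ∈ frontier D, ∀ δ > 0, ∀ᶠ j in atTop, ∃ x ∈ Metric.ball q δ, x ∉ Dseq j) :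
    IsOneParameterGroup D fun z t => G (z, t) where
  mapsTo := h.limit_mapsTo hl hG hDc hid hp hfr
  zero _ hz := h.limit_zero hl hG hz
  add _ hz t s := h.limit_add hl hG hz (h.limit_mapsTo hl hG hDc hid hp hfr t hz) s
  holomorphic t := h.limit_differentiableOn hl hG t
  continuous := continuousOn_of_contConvAt hG

end

end IsBoundedFlowSeq

end LimitFlow

/-! ### Convergence of the generators -/

section Generators

variable {n : ℕ}

/-- If the derivatives of the flow maps stay close to the identity, the flow moves each point
nearly linearly: the velocity along the orbit of `w` is the image of the initial velocity. -/
lemma IsOneParameterGroup.norm_sub_sub_smul_le {D : Set (EuclideanSpace ℂ (Fin n))}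
    {g : EuclideanSpace ℂ (Fin n) → ℝ → EuclideanSpace ℂ (Fin n)}
    {X : EuclideanSpace ℂ (Fin n) → EuclideanSpace ℂ (Fin n)} (hD : IsOpen D)
    (hg : IsOneParameterGroup D g) (hX : IsGenerator D g X) {w : EuclideanSpace ℂ (Fin n)}
    (hw : w ∈ D) {η τ : ℝ}
    (hη : ∀ s ∈ Metric.ball (0 : ℝ) τ, ‖fderiv ℂ (fun v => g v s) w
      - ContinuousLinearMap.id ℂ (EuclideanSpace ℂ (Fin n))‖ ≤ η)
    {T : ℝ} (hT : |T| < τ) : ‖g w T - w - T • X w‖ ≤ η * ‖X w‖ * |T| := by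
  have hτ : 0 < τ := (abs_nonneg T).trans_lt hT
  have := (convex_ball (0 : ℝ) τ).norm_image_sub_le_of_norm_hasDerivWithin_le
    (f := fun s => g w s - s • X w) (f' := fun s => X (g w s) - X w) (C := η * ‖X w‖)
    (x := 0) (y := T) (fun s _ => ?_) (fun s hs => ?_) (Metric.mem_ball_self hτ)
    (by simpa using hT)
  · simpa [hg.zero w hw, sub_right_comm] using this
  · have h2 := (hg.hasDerivAt hX hw s).sub ((hasDerivAt_id s).smul_const (X w))
    rw [one_smul] at h2
    exact h2.hasDerivWithinAt
  · rw [hg.generator_apply hD hX hw]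
    refine le_trans ?_ (mul_le_mul_of_nonneg_right (hη s hs) (norm_nonneg _))
    exact (fderiv ℂ (fun v => g v s) w
      - ContinuousLinearMap.id ℂ (EuclideanSpace ℂ (Fin n))).le_opNorm (X w)

variable {Dseq : ℕ → Set (EuclideanSpace ℂ (Fin n))} {D : Set (EuclideanSpace ℂ (Fin n))}
  {g : ℕ → EuclideanSpace ℂ (Fin n) → ℝ → EuclideanSpace ℂ (Fin n)} {R : ℝ}
  {X : ℕ → EuclideanSpace ℂ (Fin n) → EuclideanSpace ℂ (Fin n)}
  {l : Filter ℕ} {G : EuclideanSpace ℂ (Fin n) × ℝ → EuclideanSpace ℂ (Fin n)}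

namespace IsBoundedFlowSeq

section

variable (h : IsBoundedFlowSeq Dseq g D R) (hX : ∀ j, IsGenerator (Dseq j) (g j) (X j))
  (hid : ∀ z ∈ D, ContConvAt (fun (m : ℕ × ℝ) w => g m.1 w m.2) (atTop ×ˢ 𝓝 0) id z)

include h hX hid

lemma exists_forall_norm_sub_sub_smul_le_mul {z : EuclideanSpace ℂ (Fin n)} (hz : z ∈ D) {η : ℝ}
    (hη : 0 < η) : ∃ τ > 0, ∀ᶠ q in atTop ×ˢ 𝓝 z, ∀ T : ℝ, |T| < τ →
      ‖g q.1 q.2 T - q.2 - T • X q.1 q.2‖ ≤ η * ‖X q.1 q.2‖ * |T| := by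
  have h1 := Metric.tendsto_nhds.1 (h.tendsto_fderiv_id hid hz) η hη
  obtain ⟨pa, hpa, pb, hpb, hab⟩ := eventually_prod_iff.1 h1
  obtain ⟨pc, hpc, pd, hpd, hcd⟩ := eventually_prod_iff.1 hpa
  obtain ⟨τ, hτ, hτb⟩ := Metric.eventually_nhds_iff_ball.1 hpd
  refine ⟨τ, hτ, ?_⟩
  filter_upwards [hpc.prod_mk hpb, h.eventually_mem z hz] with q hq hqD T hT
  refine (h.isOneParameterGroup q.1).norm_sub_sub_smul_le (h.isOpen_seq q.1) (hX q.1) hqD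
    (fun s hs => ?_) hT
  have := hab (hcd hq.1 (hτb s hs)) hq.2
  rw [dist_eq_norm] at this
  exact this.le

/-- The generators are locally bounded: for small `T` the displacement `g j (w, T) - w` is
comparable to `T • X j w`, and it is bounded because the domains are. -/
lemma exists_eventually_norm_le {z : EuclideanSpace ℂ (Fin n)} (hz : z ∈ D) :
    ∃ C > 0, ∀ᶠ q in atTop ×ˢ 𝓝 z, ‖X q.1 q.2‖ ≤ C := by
  obtain ⟨τ, hτ, hev⟩ := h.exists_forall_norm_sub_sub_smul_le_mul hX hid hz
    (show (0 : ℝ) < 1 / 2 by norm_num)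
  refine ⟨8 * |R| / τ + 1, by positivity, ?_⟩
  filter_upwards [hev, h.eventually_mem z hz, h.eventually_subset.prod_inl (𝓝 z)] with q h1 h2 h3
  have hT : |τ / 2| = τ / 2 := abs_of_pos (by positivity)
  have h4 := h1 (τ / 2) (by rw [hT]; linarith)
  rw [hT, norm_sub_rev] at h4
  have h5 := mem_closedBall_zero_iff.1 (h3 h2)
  have h6 := mem_closedBall_zero_iff.1 (h3 ((h.isOneParameterGroup q.1).mapsTo (τ / 2) h2))
  have h7 := norm_sub_norm_le ((τ / 2) • X q.1 q.2) (g q.1 q.2 (τ / 2) - q.2)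
  rw [norm_smul, Real.norm_eq_abs, hT] at h7
  have h8 := _root_.norm_sub_le (g q.1 q.2 (τ / 2)) q.2
  simp only at h6
  have h9 : ‖X q.1 q.2‖ * τ ≤ 8 * |R| := by linarith [le_abs_self R]
  have := (le_div_iff₀ hτ).2 h9
  linarith

/-- Uniformly in the index, `X j w` is approximated by difference quotients in time. -/
lemma exists_forall_norm_sub_sub_smul_le {z : EuclideanSpace ℂ (Fin n)} (hz : z ∈ D) {ε : ℝ}
    (hε : 0 < ε) : ∃ τ > 0, ∀ᶠ q in atTop ×ˢ 𝓝 z, ∀ T : ℝ, |T| < τ →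
      ‖g q.1 q.2 T - q.2 - T • X q.1 q.2‖ ≤ ε * |T| := by
  obtain ⟨C, hC, hCb⟩ := h.exists_eventually_norm_le hX hid hz
  obtain ⟨τ, hτ, hev⟩ := h.exists_forall_norm_sub_sub_smul_le_mul hX hid hz
    (show 0 < ε / C by positivity)
  refine ⟨τ, hτ, ?_⟩
  filter_upwards [hev, hCb] with q h1 h2 T hT
  refine (h1 T hT).trans (mul_le_mul_of_nonneg_right ?_ (abs_nonneg T))
  calc ε / C * ‖X q.1 q.2‖ ≤ ε / C * C := by gcongr
    _ = ε := div_mul_cancel₀ _ hC.ne'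

variable [NeBot l] (hl : l ≤ atTop)
  (hG : ∀ q ∈ D ×ˢ (univ : Set ℝ), ContConvAt
    (fun j (q : EuclideanSpace ℂ (Fin n) × ℝ) => g j q.1 q.2) l G q)

include hl hG

/-- The generators converge locally uniformly along with the flows. -/
lemma exists_contConvAt_generator :
    ∃ X' : EuclideanSpace ℂ (Fin n) → EuclideanSpace ℂ (Fin n), ∀ z ∈ D, ContConvAt X l X' z := by
  have key : ∀ z ∈ D, ∃ x, Tendsto (fun q : ℕ × EuclideanSpace ℂ (Fin n) => X q.1 q.2)
      (l ×ˢ 𝓝 z) (𝓝 x) := by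
    intro z hz
    refine cauchy_map_iff_exists_tendsto.1 (cauchy_map_iff.2 ⟨inferInstance, ?_⟩)
    rw [Metric.uniformity_basis_dist.tendsto_right_iff]
    intro ε hε
    obtain ⟨τ, hτ, hev⟩ := h.exists_forall_norm_sub_sub_smul_le hX hid hz
      (show 0 < ε / 8 by positivity)
    have hT : |τ / 2| = τ / 2 := abs_of_pos (by positivity)
    set Y : ℕ × EuclideanSpace ℂ (Fin n) → EuclideanSpace ℂ (Fin n) := fun q =>
      (τ / 2)⁻¹ • (g q.1 q.2 (τ / 2) - q.2) with hY
    have hYlim : Tendsto Y (l ×ˢ 𝓝 z) (𝓝 ((τ / 2)⁻¹ • (G (z, τ / 2) - z))) := by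
      have h1 : Tendsto (fun m : ℕ × EuclideanSpace ℂ (Fin n) => g m.1 m.2 (τ / 2)) (l ×ˢ 𝓝 z)
          (𝓝 (G (z, τ / 2))) := contConvAt_slice (hG (z, τ / 2) ⟨hz, mem_univ _⟩)
      exact (h1.sub tendsto_snd).const_smul _
    have hclose : ∀ᶠ q in l ×ˢ 𝓝 z, dist (X q.1 q.2) ((τ / 2)⁻¹ • (G (z, τ / 2) - z)) < ε / 2 := by
      filter_upwards [hev.filter_mono (prod_mono hl le_rfl),
        Metric.tendsto_nhds.1 hYlim (ε / 4) (by positivity)] with q h1 h2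
      have h3 := h1 (τ / 2) (by rw [hT]; linarith)
      rw [hT] at h3
      have h4 : dist (X q.1 q.2) (Y q) ≤ ε / 8 := by
        have h5 : Y q - X q.1 q.2
            = (τ / 2)⁻¹ • (g q.1 q.2 (τ / 2) - q.2 - (τ / 2) • X q.1 q.2) := by
          rw [smul_sub _ (g q.1 q.2 (τ / 2) - q.2), smul_smul,
            inv_mul_cancel₀ (by positivity), one_smul]
        rw [dist_comm, dist_eq_norm, h5, norm_smul, norm_inv, Real.norm_eq_abs, hT,
          inv_mul_le_iff₀ (by positivity)]
        linarith
      have := dist_triangle (X q.1 q.2) (Y q) ((τ / 2)⁻¹ • (G (z, τ / 2) - z))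
      linarith
    filter_upwards [hclose.prod_mk hclose] with m hm
    have := dist_triangle_right (X m.1.1 m.1.2) (X m.2.1 m.2.2) ((τ / 2)⁻¹ • (G (z, τ / 2) - z))
    have h1 := hm.1
    have h2 := hm.2
    exact this.trans_lt (by linarith)
  choose! X' hX' using key
  exact ⟨X', hX'⟩

variable {X' : EuclideanSpace ℂ (Fin n) → EuclideanSpace ℂ (Fin n)}
  (hX' : ∀ z ∈ D, ContConvAt X l X' z)

include hX'

lemma exists_forall_limit_norm_sub_sub_smul_le {z : EuclideanSpace ℂ (Fin n)} (hz : z ∈ D) {ε : ℝ}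
    (hε : 0 < ε) : ∃ τ > 0, ∀ᶠ w in 𝓝 z, ∀ T : ℝ, |T| < τ →
      ‖G (w, T) - w - T • X' w‖ ≤ ε * |T| := by
  obtain ⟨τ, hτ, hev⟩ := h.exists_forall_norm_sub_sub_smul_le hX hid hz hε
  obtain ⟨pa, hpa, pb, hpb, hab⟩ := eventually_prod_iff.1 hev
  refine ⟨τ, hτ, ?_⟩
  filter_upwards [hpb, h.isOpen.mem_nhds hz] with w hw hwD T hT
  have hlim := (((hG (w, T) ⟨hwD, mem_univ _⟩).tendsto.sub_const w).sub
    ((hX' w hwD).tendsto.const_smul T)).norm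
  exact le_of_tendsto hlim ((hpa.filter_mono hl).mono fun j hj => hab hj hw T hT)

lemma isGenerator_limit : IsGenerator D (fun z t => G (z, t)) X' := by
  intro z hz
  rw [hasDerivAt_iff_isLittleO, Asymptotics.isLittleO_iff]
  intro ε hε
  obtain ⟨τ, hτ, hev⟩ := h.exists_forall_limit_norm_sub_sub_smul_le hX hid hl hG hX' hz hε
  filter_upwards [Metric.ball_mem_nhds (0 : ℝ) hτ] with T hT
  have := hev.self_of_nhds T (by simpa using hT)
  rwa [h.limit_zero hl hG hz, sub_zero, Real.norm_eq_abs]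

/-- The limit field is holomorphic, as a locally uniform limit of the holomorphic maps
`w ↦ T⁻¹ • (G (w, T) - w)`. -/
lemma differentiableOn_limit_generator : DifferentiableOn ℂ X' D := by
  intro z hz
  refine (differentiableAt_of_contConvAt (l := 𝓝[≠] (0 : ℝ)) (U := D)
    (G := fun (T : ℝ) w => T⁻¹ • (G (w, T) - w)) h.isOpen ?_ ?_ hz).differentiableWithinAt
  · intro z hz
    filter_upwards [tendsto_snd.eventually (h.isOpen.eventually_mem hz)] with q hq
    exact (((h.limit_differentiableOn hl hG q.1).differentiableAt (h.isOpen.mem_nhds hq)).sub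
      differentiableAt_id).const_smul q.1⁻¹
  · intro z hz
    rw [ContConvAt, Metric.tendsto_nhds]
    intro ε hε
    obtain ⟨τ, hτ, hev⟩ := h.exists_forall_limit_norm_sub_sub_smul_le hX hid hl hG hX' hz
      (show 0 < ε / 2 by positivity)
    have hcont : ContinuousAt X' z :=
      (continuousOn_of_contConvAt hX').continuousAt (h.isOpen.mem_nhds hz)
    have hT : ∀ᶠ T in 𝓝[≠] (0 : ℝ), T ∈ Metric.ball (0 : ℝ) τ ∧ T ≠ 0 :=
      (eventually_nhdsWithin_of_eventually_nhds (Metric.ball_mem_nhds (0 : ℝ) hτ)).and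
        self_mem_nhdsWithin
    filter_upwards [hT.prod_mk (hev.and (Metric.tendsto_nhds.1 hcont (ε / 2) (by positivity)))]
      with q hq
    obtain ⟨⟨h1, h2⟩, h3, h4⟩ := hq
    have h5 := h3 q.1 (by simpa using h1)
    have h6 : dist (q.1⁻¹ • (G (q.2, q.1) - q.2)) (X' q.2) ≤ ε / 2 := by
      have h7 : q.1⁻¹ • (G (q.2, q.1) - q.2) - X' q.2
          = q.1⁻¹ • (G (q.2, q.1) - q.2 - q.1 • X' q.2) := by
        rw [smul_sub _ (G (q.2, q.1) - q.2), smul_smul, inv_mul_cancel₀ h2, one_smul]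
      rw [dist_eq_norm, h7, norm_smul, norm_inv, Real.norm_eq_abs,
        inv_mul_le_iff₀ (abs_pos.2 h2)]
      linarith
    have := dist_triangle (q.1⁻¹ • (G (q.2, q.1) - q.2)) (X' q.2) (X' z)
    linarith

end

end IsBoundedFlowSeq

end Generators

/-! ### Uniform convergence on compacta of groups and generators -/

lemma tendstoOnCompacta_of_contConvAt {α β : Type*} [TopologicalSpace α] [PseudoMetricSpace β]
    {S : ℕ → Set α} {F : ℕ → α → β} {T : Set α} {f : α → β} {φ : ℕ → ℕ} (hφ : StrictMono φ)
    (hmem : ∀ z ∈ T, ∀ᶠ q in atTop ×ˢ 𝓝 z, q.2 ∈ S q.1)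
    (hF : ∀ z ∈ T, ContConvAt F (map φ atTop) f z) :
    TendstoOnCompacta (fun k => S (φ k)) (fun k => F (φ k)) T f := by
  intro K hKT hK
  constructor
  · exact hφ.tendsto_atTop.eventually (eventually_forall_mem_of_isCompact
      (P := fun j z => z ∈ S j) hK fun z hz => hmem z (hKT hz))
  · have := tendstoUniformlyOn_of_contConvAt hK fun z hz => hF z (hKT hz)
    exact fun u hu => eventually_map.1 (this u hu)

theorem theoremT {n : ℕ}
    (Dseq : ℕ → Set (EuclideanSpace ℂ (Fin n))) (D : Set (EuclideanSpace ℂ (Fin n)))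
    (hDseq : ∀ j, IsBoundedDomain (Dseq j)) (hD : IsBoundedDomain D)
    (hlim : Tendsto (fun j => boundaryDist (Dseq j) D) atTop (𝓝 0))
    (p : EuclideanSpace ℂ (Fin n)) (r a : ℝ) (hr : 0 < r) (ha : 0 < a)
    (hball : ∀ j, Metric.ball p (r + a) ⊆ Dseq j) (hp : p ∈ D)
    (g : ℕ → EuclideanSpace ℂ (Fin n) → ℝ → EuclideanSpace ℂ (Fin n))
    (X : ℕ → EuclideanSpace ℂ (Fin n) → EuclideanSpace ℂ (Fin n))
    (hg : ∀ j, IsOneParameterGroup (Dseq j) (g j))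
    (hnontriv : ∀ j, IsNontrivialOn (Dseq j) (g j))
    (hX : ∀ j, IsGenerator (Dseq j) (g j) (X j))
    (hnorm : ∀ j, IsLUB ((fun z => ‖X j z‖) '' Metric.ball p r) 1) :
    ∃ φ : ℕ → ℕ, StrictMono φ ∧
      ∃ (g' : EuclideanSpace ℂ (Fin n) → ℝ → EuclideanSpace ℂ (Fin n))
        (X' : EuclideanSpace ℂ (Fin n) → EuclideanSpace ℂ (Fin n)),
        IsOneParameterGroup D g' ∧ IsNontrivialOn D g' ∧
        IsGenerator D g' X' ∧ DifferentiableOn ℂ X' D ∧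
        TendstoOnCompacta (fun k => Dseq (φ k) ×ˢ (univ : Set ℝ))
          (fun k q => g (φ k) q.1 q.2) (D ×ˢ (univ : Set ℝ)) (fun q => g' q.1 q.2) ∧
        TendstoOnCompacta (fun k => Dseq (φ k)) (fun k => X (φ k)) D X' := by
  obtain ⟨z₁, -, t₁, hne⟩ := hnontriv 0
  have : Nontrivial (EuclideanSpace ℂ (Fin n)) := ⟨_, _, hne⟩
  have hra : 0 < r + a := by linarith
  have hballr : ∀ j, Metric.ball p r ⊆ Dseq j := fun j =>
    (Metric.ball_subset_ball (by linarith)).trans (hball j)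
  have hclosed : Metric.closedBall p r ⊆ D := (Metric.closedBall_subset_ball (by linarith)).trans
    (ball_subset_of_forall_ball_subset hDseq hD hlim hra hp hball)
  obtain ⟨R, hR, hRsub⟩ := exists_eventually_subset_closedBall hDseq hD hlim
  have hmem : ∀ z ∈ D, ∀ᶠ q in atTop ×ˢ 𝓝 z, q.2 ∈ Dseq q.1 := fun z hz =>
    eventually_mem_nhds hDseq hD hlim hp (fun j => hball j (Metric.mem_ball_self hra)) hz
  have h : IsBoundedFlowSeq Dseq g D R :=
    ⟨hD.isOpen, fun j => (hDseq j).isOpen, hg, hmem, hRsub⟩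
  have hDc : IsPreconnected D := hD.isConnected.isPreconnected
  have hid : ∀ z ∈ D, ContConvAt (fun (m : ℕ × ℝ) w => g m.1 w m.2) (atTop ×ˢ 𝓝 0) id z := by
    refine fun z hz => h.contConvAt_id hDc hp ?_ hz
    filter_upwards [Metric.ball_mem_nhds p (show 0 < r / 2 by positivity)] with w hw
    rw [tendsto_iff_dist_tendsto_zero]
    have hsnd : Tendsto (fun m : ℕ × ℝ => 2 * |m.2|) (atTop ×ˢ 𝓝 0) (𝓝 0) := by
      have : Tendsto (fun t : ℝ => 2 * |t|) (𝓝 0) (𝓝 (2 * |0|)) :=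
        (by fun_prop : Continuous fun t : ℝ => 2 * |t|).tendsto _
      rw [abs_zero, mul_zero] at this
      exact this.comp tendsto_snd
    refine squeeze_zero' (Eventually.of_forall fun _ => dist_nonneg) ?_ hsnd
    filter_upwards [tendsto_snd.eventually
      (Metric.closedBall_mem_nhds (0 : ℝ) (show 0 < r / 8 by positivity))] with m hm
    rw [dist_eq_norm]
    exact (hg m.1).norm_sub_le (hX m.1) hr (hballr m.1)
      (fun v hv => (hnorm m.1).1 ⟨v, hv, rfl⟩) hw (by simpa using hm)
  obtain ⟨φ, hφ, G, hG⟩ := h.exists_subseq hR.le hid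
  have hl : map φ atTop ≤ atTop := hφ.tendsto_atTop
  obtain ⟨X', hX'⟩ := h.exists_contConvAt_generator hX hid hl hG
  have hgen := h.isGenerator_limit hX hid hl hG hX'
  refine ⟨φ, hφ, fun z t => G (z, t), X',
    h.isOneParameterGroup_limit hl hG hDc hid hp
      fun q hq δ hδ => eventually_exists_notMem hDseq hD hlim hq hδ,
    ?_, hgen, h.differentiableOn_limit_generator hX hid hl hG hX', ?_,
    tendstoOnCompacta_of_contConvAt hφ hmem hX'⟩
  · -- A trivial limit group has generator `0`, against the normalisation on `ball p r`.
    by_contra htriv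
    have hfix : ∀ z ∈ D, ∀ t, G (z, t) = z := by
      intro z hz t
      by_contra hne
      exact htriv ⟨z, hz, t, hne⟩
    have hzero : ∀ z ∈ D, X' z = 0 := fun z hz =>
      (hgen z hz).unique ((hasDerivAt_const (0 : ℝ) z).congr_of_eventuallyEq
        (Eventually.of_forall fun t => hfix z hz t))
    have hunif := Metric.tendstoUniformlyOn_iff.1 (tendstoUniformlyOn_of_contConvAt
      (isCompact_closedBall p r) fun z hz => hX' z (hclosed hz)) (1 / 2) (by norm_num)
    obtain ⟨j, hj⟩ := hunif.exists
    have h1 : (1 : ℝ) ≤ 1 / 2 := by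
      refine (hnorm j).2 ?_
      rintro _ ⟨w, hw, rfl⟩
      have hw' := Metric.ball_subset_closedBall hw
      have := hj w hw'
      rw [hzero w (hclosed hw'), dist_zero_left] at this
      exact this.le
    norm_num at h1
  · refine tendstoOnCompacta_of_contConvAt (S := fun j => Dseq j ×ˢ (univ : Set ℝ))
      (F := fun j (q : EuclideanSpace ℂ (Fin n) × ℝ) => g j q.1 q.2) hφ ?_ hG
    rintro ⟨z, t⟩ ⟨hz, -⟩
    have ht : Tendsto (fun m : ℕ × EuclideanSpace ℂ (Fin n) × ℝ => (m.1, m.2.1))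
        (atTop ×ˢ 𝓝 (z, t)) (atTop ×ˢ 𝓝 z) :=
      tendsto_fst.prodMk ((continuous_fst.tendsto _).comp tendsto_snd)
    exact (ht.eventually (hmem z hz)).mono fun m hm => ⟨hm, mem_univ _⟩
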